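/- Let $\mathfrak{S}_n$ be the set of permutations $\sigma=\sigma(1)\sigma(2)\cdots\sigma(n)$ of $[n]=\{1,\dots,n\}$. For $\sigma\in\mathfrak{S}_n$ let $\mathrm{exc}(\sigma)$ be the number of $i\in[n]$ with $i<\sigma(i)$; $\mathrm{des}(\sigma)$ the number of $i\in[n-1]$ with $\sigma(i)>\sigma(i+1)$; $\mathrm{dd}(\sigma)$ the number of $i\in[n]$ with $\sigma(i-1)>\sigma(i)>\sigma(i+1)$, where $\sigma(0)=\sigma(n+1)=0$; and $\mathrm{inv}(\sigma)$ the number of pairs $i<j$ in $[n]$ with $\sigma(i)>\sigma(j)$ (always $\mathrm{exc}(\sigma)\le\mathrm{inv}(\sigma)$). Let $(31\text{-}2)\sigma$ be the number of pairs $(i,j)$ with $2\le i<j\le n$ and $\sigma(i-1)>\sigma(j)>\sigma(i)$, and let $(2\text{-}13)\sigma$ be the number of pairs $(i,j)$ with $1\le i<j\le n$ and $\sigma(j)>\sigma(i)>\sigma(j-1)$. Put $DD_{n,k}=\{\sigma\in\mathfrak{S}_n:\mathrm{des}(\sigma)=k,\ \mathrm{dd}(\sigma)=0\}$. **Theorem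 (Shin and Zeng).** For every $n\ge 1$, $$ \sum_{\sigma\in\mathfrak{S}_n}q^{\mathrm{inv}(\sigma)-\mathrm{exc}(\sigma)}t^{\mathrm{exc}(\sigma)} =\sum_{k=0}^{\lfloor (n-1)/2\rfloor}\Bigl(\sum_{\sigma\in DD_{n,k}}q^{2\,(2\text{-}13)\sigma+(31\text{-}2)\sigma}\Bigr)t^k(1+t)^{n-1-2k} $$ as polynomials in $q$ and $t$ (equivalently, for all elements $q,t$ of any commutative semiring). -/

import Mathlib

namespace PermStat

open Finset

/-- The word `σ(1) σ(2) ⋯ σ(n)` of a permutation of `[n] = {1, …, n}`, as a function on `ℕ` with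
values in `ℕ`, extended by `0` outside `[n]`; in particular `σ(0) = σ(n+1) = 0`.
The element `i : Fin n` stands for the element `i + 1` of `[n]`. -/
def word {n : ℕ} (σ : Equiv.Perm (Fin n)) (i : ℕ) : ℕ :=
  if h : 1 ≤ i ∧ i ≤ n then (σ ⟨i - 1, by omega⟩ : ℕ) + 1 else 0

/-- The number of excedances: `i ∈ [n]` with `i < σ(i)`. -/
def exc {n : ℕ} (σ : Equiv.Perm (Fin n)) : ℕ :=
  #{i ∈ Icc 1 n | i < word σ i}

/-- The number of descents: `i ∈ [n-1]` with `σ(i) > σ(i+1)`. -/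
def des {n : ℕ} (σ : Equiv.Perm (Fin n)) : ℕ :=
  #{i ∈ Icc 1 (n - 1) | word σ i > word σ (i + 1)}

/-- The number of double descents: `i ∈ [n]` with `σ(i-1) > σ(i) > σ(i+1)`,
where `σ(0) = σ(n+1) = 0`. -/
def dd {n : ℕ} (σ : Equiv.Perm (Fin n)) : ℕ :=
  #{i ∈ Icc 1 n | word σ (i - 1) > word σ i ∧ word σ i > word σ (i + 1)}

/-- The number of inversions: pairs `i < j` in `[n]` with `σ(i) > σ(j)`. -/
def inv {n : ℕ} (σ : Equiv.Perm (Fin n)) : ℕ :=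
  #{p ∈ Icc 1 n ×ˢ Icc 1 n | p.1 < p.2 ∧ word σ p.1 > word σ p.2}

/-- The statistic `(31-2) σ`: pairs `(i, j)` with `2 ≤ i < j ≤ n` and `σ(i-1) > σ(j) > σ(i)`. -/
def pat31_2 {n : ℕ} (σ : Equiv.Perm (Fin n)) : ℕ :=
  #{p ∈ Icc 2 n ×ˢ Icc 2 n |
    p.1 < p.2 ∧ word σ (p.1 - 1) > word σ p.2 ∧ word σ p.2 > word σ p.1}

/-- The statistic `(2-13) σ`: pairs `(i, j)` with `1 ≤ i < j ≤ n` and `σ(j) > σ(i) > σ(j-1)`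
(the last inequality forces `i < j - 1`). -/
def pat2_13 {n : ℕ} (σ : Equiv.Perm (Fin n)) : ℕ :=
  #{p ∈ Icc 1 n ×ˢ Icc 1 n |
    p.1 < p.2 ∧ word σ p.2 > word σ p.1 ∧ word σ p.1 > word σ (p.2 - 1)}

/-- The set `DD_{n,k}` of permutations of `[n]` with `k` descents and no double descents. -/
def DD (n k : ℕ) : Finset (Equiv.Perm (Fin n)) :=
  {σ | des σ = k ∧ dd σ = 0}

/-- `exc σ ≤ inv σ`, so that the natural-number difference `inv σ - exc σ` is the true one. -/
theorem exc_le_inv {n : ℕ} (σ : Equiv.Perm (Fin n)) : exc σ ≤ inv σ := by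
  classical
  unfold exc inv
  have key : ∀ i ∈ ({i ∈ Icc 1 n | i < word σ i} : Finset ℕ),
      ∃ j, (i, j) ∈ ({p ∈ Icc 1 n ×ˢ Icc 1 n |
        p.1 < p.2 ∧ word σ p.1 > word σ p.2} : Finset (ℕ × ℕ)) := by
    intro i hi
    simp only [mem_filter, mem_Icc] at hi
    obtain ⟨⟨h1, h2⟩, h3⟩ := hi
    by_contra hcon
    push Not at hcon
    have hw : ∀ j (h : j < n), word σ (j + 1) = (σ ⟨j, h⟩ : ℕ) + 1 := by
      intro j h
      unfold word
      rw [dif_pos ⟨by omega, by omega⟩]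
      rfl
    obtain ⟨i, rfl⟩ : ∃ m, i = m + 1 := ⟨i - 1, by omega⟩
    have hin : i < n := by omega
    rw [hw i hin] at h3
    have hall : ∀ j ∈ Ici (⟨i, hin⟩ : Fin n), σ j ∈ Ioi (⟨i, hin⟩ : Fin n) := by
      rintro ⟨j, hj⟩ hij
      simp only [mem_Ici, Fin.mk_le_mk] at hij
      simp only [mem_Ioi, Fin.lt_def]
      rcases Nat.eq_or_lt_of_le hij with rfl | hlt
      · omega
      · have := hcon (j + 1)
        simp only [mem_filter, mem_product, mem_Icc, hw j hj, hw i hin] at this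
        omega
    have hc := Finset.card_le_card_of_injOn σ hall σ.injective.injOn
    simp only [Fin.card_Ici, Fin.card_Ioi] at hc
    omega
  choose! f hf using key
  exact Finset.card_le_card_of_injOn (fun i => (i, f i)) hf
    (fun a _ b _ h => (Prod.mk.inj h).1)

end PermStat

namespace PermStat

open Finset

section Bracket

variable {R : Type*} [CommSemiring R]

/-- The `(q, p)`-integer `∑ qⁱ p^(k-1-i)`, the sum being over `0 ≤ i < k`. -/
def brk (q p : R) : ℕ → R
  | 0 => 0
  | k + 1 => p ^ k + q * brk q p k

theorem brk_sq (q : R) (k : ℕ) : brk q (q ^ 2) (k + 1) = q ^ k * brk 1 q (k + 1) := by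
  induction k with
  | zero => simp [brk]
  | succ k ih =>
    rw [brk, ih, brk.eq_2 1 q (k + 1)]
    ring

theorem sum_pow_card_lt (q : R) (T : Finset ℕ) :
    ∑ v ∈ T, q ^ #{c ∈ T | c < v} = brk 1 q #T := by
  induction T using Finset.induction_on_max with
  | empty => simp [brk]
  | insert a s ha ih =>
    have has : a ∉ s := fun h => lt_irrefl _ (ha a h)
    rw [sum_insert has, card_insert_of_notMem has, brk, one_mul, ← ih]
    congr 1
    · congr 2
      ext c
      simp only [mem_filter, mem_insert]
      constructor
      · rintro ⟨rfl | h, h'⟩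
        · exact absurd h' (lt_irrefl _)
        · exact h
      · exact fun h => ⟨Or.inr h, ha c h⟩
    · refine sum_congr rfl fun v hv => ?_
      congr 2
      ext c
      simp only [mem_filter, mem_insert]
      have := ha v hv
      constructor
      · rintro ⟨rfl | h, h'⟩
        · omega
        · exact ⟨h, h'⟩
      · exact fun h => ⟨Or.inr h.1, h.2⟩

end Bracket

section Splits

/-- All ways of writing a list as `x ++ a :: y`. -/
def splits (a : ℕ) : List ℕ → Finset (List ℕ × List ℕ)
  | [] => ∅
  | c :: l =>
    (if c = a then {([], l)} else ∅) ∪ (splits a l).image fun p => (c :: p.1, p.2)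

theorem mem_splits {a : ℕ} {w : List ℕ} {p : List ℕ × List ℕ} :
    p ∈ splits a w ↔ w = p.1 ++ a :: p.2 := by
  obtain ⟨x, y⟩ := p
  induction w generalizing x y with
  | nil => simp [splits]
  | cons c l ih =>
    simp only [splits, mem_union, mem_image, Prod.exists, ih, Prod.mk.injEq]
    constructor
    · rintro (h | ⟨x', y', rfl, rfl, rfl⟩)
      · split_ifs at h with hc
        · simp at h
          simp [h, hc]
        · simp at h
      · simp
    · intro h
      cases x with
      | nil =>
        simp at h
        left
        simp [h]
      | cons d x =>
        simp at h
        exact Or.inr ⟨x, y, h.2, by simp [h.1], rfl⟩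

theorem sum_splits {R : Type*} [CommSemiring R] (q p : R) (a : ℕ) (w : List ℕ) :
    ∑ z ∈ splits a w, q ^ z.1.count a * p ^ z.2.count a = brk q p (w.count a) := by
  induction w with
  | nil => simp [splits, brk]
  | cons c l ih =>
    have hinj : Function.Injective fun z : List ℕ × List ℕ => (c :: z.1, z.2) := by
      rintro ⟨x, y⟩ ⟨x', y'⟩ h
      simpa using h
    rw [splits, sum_union, sum_image hinj.injOn]
    · by_cases hc : c = a
      · subst hc
        simp only [if_true, sum_singleton, List.count_nil, List.count_cons_self, brk, ← ih,
          mul_sum]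
        simp [pow_succ, mul_comm q, mul_assoc]
      · simp [hc, ih]
    · rw [Finset.disjoint_left]
      rintro ⟨x, y⟩ h h'
      split_ifs at h
      · simp at h h'
        simp [h.1] at h'
      · simp at h

/-- The pairs `(x, y)` for which `x ++ a :: y` lies in a given set. -/
def allSplits (a : ℕ) (E : Finset (List ℕ)) : Finset (List ℕ × List ℕ) :=
  E.biUnion (splits a)

theorem mem_allSplits {a : ℕ} {E : Finset (List ℕ)} {p : List ℕ × List ℕ} :
    p ∈ allSplits a E ↔ p.1 ++ a :: p.2 ∈ E := by
  simp [allSplits, mem_splits]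

theorem sum_allSplits {R : Type*} [CommSemiring R] (q p : R) (a : ℕ) (E : Finset (List ℕ))
    (G : List ℕ → R) :
    ∑ z ∈ allSplits a E, G (z.1 ++ a :: z.2) * (q ^ z.1.count a * p ^ z.2.count a) =
      ∑ w ∈ E, G w * brk q p (w.count a) := by
  rw [allSplits, sum_biUnion]
  · refine sum_congr rfl fun w _ => ?_
    rw [← sum_splits, mul_sum]
    refine sum_congr rfl fun z hz => ?_
    rw [← mem_splits.1 hz]
  · intro w _ w' _ hne
    rw [Function.onFun, Finset.disjoint_left]
    intro z hz hz'
    exact hne ((mem_splits.1 hz).trans (mem_splits.1 hz').symm)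

end Splits

section Bump

/-- The increasing enumeration of the natural numbers different from `c`. -/
def bump (c v : ℕ) : ℕ := if v < c then v else v + 1

theorem bump_strictMono (c : ℕ) : StrictMono (bump c) := by
  intro a b h
  unfold bump
  split_ifs <;> omega

theorem bump_of_lt {c v : ℕ} (h : v < c) : bump c v = v := if_pos h

theorem bump_self (c : ℕ) : bump c c = c + 1 := if_neg (lt_irrefl c)

theorem bump_ne (c v : ℕ) : bump c v ≠ c := by
  unfold bump
  split_ifs <;> omega

theorem bump_injective (c : ℕ) : Function.Injective (bump c) := (bump_strictMono c).injective

theorem notMem_map_bump (c : ℕ) (l : List ℕ) : c ∉ l.map (bump c) := by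
  simp [bump_ne]

theorem count_map_bump_self (c : ℕ) (l : List ℕ) : (l.map (bump c)).count c = 0 :=
  List.count_eq_zero.2 (notMem_map_bump c l)

theorem count_succ_map_bump (c : ℕ) (l : List ℕ) :
    (l.map (bump c)).count (c + 1) = l.count c := by
  rw [← bump_self c]
  exact List.count_map_of_injective _ _ (bump_injective c) _

theorem count_map_bump_of_lt {c v : ℕ} (h : v < c) (l : List ℕ) :
    (l.map (bump c)).count v = l.count v := by
  conv_lhs => rw [← bump_of_lt h]
  exact List.count_map_of_injective _ _ (bump_injective c) _

theorem mem_map_bump_of_lt {c v : ℕ} (h : v < c) (l : List ℕ) :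
    v ∈ l.map (bump c) ↔ v ∈ l := by
  rw [← List.count_pos_iff, count_map_bump_of_lt h, List.count_pos_iff]

theorem exists_map_bump {c : ℕ} {l : List ℕ} (h : c ∉ l) : ∃ l' : List ℕ, l = l'.map (bump c) := by
  induction l with
  | nil => exact ⟨[], rfl⟩
  | cons a l ih =>
    simp only [List.mem_cons, not_or] at h
    obtain ⟨l', rfl⟩ := ih h.2
    refine ⟨(if a < c then a else a - 1) :: l', ?_⟩
    have : bump c (if a < c then a else a - 1) = a := by
      unfold bump
      have := h.1
      split_ifs <;> omega
    simp [this]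

theorem map_bump_append_cons_inj {c : ℕ} {x y x' y' : List ℕ}
    (h : x.map (bump c) ++ c :: y.map (bump c) = x'.map (bump c) ++ c :: y'.map (bump c)) :
    x = x' ∧ y = y' := by
  have h' := (List.append_cons_inj_of_notMem (notMem_map_bump c x) (notMem_map_bump c y)).1 h
  exact ⟨List.map_injective_iff.2 (bump_injective c) h'.1,
    List.map_injective_iff.2 (bump_injective c) h'.2.2⟩

end Bump

section PartialWords

/-- The lists of length `a` with letters at most `b`, in which each letter below `b` occurs at
most once. They are reversed words of partial permutations, the letter `b` standing for a value
that is still to be chosen. -/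
def partialWords (a b : ℕ) : Finset (List ℕ) :=
  {f ∈ (univ : Finset (Fin a → Fin (b + 1))).image fun g => List.ofFn fun i => (g i : ℕ) |
    ∀ c < b, f.count c ≤ 1}

theorem mem_partialWords {a b : ℕ} {f : List ℕ} :
    f ∈ partialWords a b ↔
      f.length = a ∧ (∀ v ∈ f, v ≤ b) ∧ ∀ c < b, f.count c ≤ 1 := by
  simp only [partialWords, mem_filter, mem_image, mem_univ, true_and, ← and_assoc]
  refine and_congr_left fun _ => ⟨?_, ?_⟩
  · rintro ⟨g, rfl⟩
    refine ⟨by simp, fun v hv => ?_⟩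
    rw [List.mem_ofFn] at hv
    obtain ⟨i, rfl⟩ := hv
    omega
  · rintro ⟨rfl, h⟩
    refine ⟨fun i => ⟨f[i], Nat.lt_succ_of_le (h _ (List.getElem_mem _))⟩, ?_⟩
    simp

/-- The sum over the letters `v` of the number of `c < v` that do not occur to the right of `v`. -/
def codeSum : List ℕ → ℕ
  | [] => 0
  | v :: l => #{c ∈ range v | c ∉ l} + codeSum l

/-- The number of letters that exceed their position, counted from `0` and from the right. -/
def excList : List ℕ → ℕ
  | [] => 0
  | v :: l => (if l.length < v then 1 else 0) + excList l

theorem excList_le_codeSum (l : List ℕ) : excList l ≤ codeSum l := by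
  induction l with
  | nil => simp [excList, codeSum]
  | cons v l ih =>
    rw [excList, codeSum]
    refine Nat.add_le_add ?_ ih
    split_ifs with h
    · have h1 : (range v \ l.toFinset) = {c ∈ range v | c ∉ l} := by
        ext c
        simp
      have h2 := Finset.le_card_sdiff l.toFinset (range v)
      have h3 := l.toFinset_card_le
      rw [h1, card_range] at h2
      omega
    · omega

theorem codeSum_map_bump {b : ℕ} {l : List ℕ} (h : ∀ v ∈ l, v ≤ b) :
    codeSum (l.map (bump b)) = codeSum l + l.count b := by
  induction l with
  | nil => simp [codeSum]
  | cons v l ih =>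
    simp only [List.mem_cons, forall_eq_or_imp] at h
    rw [List.map_cons, codeSum, codeSum, ih h.2]
    have key : ∀ c < b, c ∉ l.map (bump b) ↔ c ∉ l := fun c hc =>
      not_congr (mem_map_bump_of_lt hc l)
    rcases h.1.lt_or_eq with hv | rfl
    · rw [bump_of_lt hv, List.count_cons_of_ne hv.ne, filter_congr fun c hc =>
        key c ((mem_range.1 hc).trans hv)]
      omega
    · rw [bump_self, List.count_cons_self, range_add_one, filter_insert,
        if_pos (notMem_map_bump v l), card_insert_of_notMem (by simp), filter_congr fun c hc =>
        key c (mem_range.1 hc)]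
      omega

theorem codeSum_map_bump_append {b : ℕ} {x y : List ℕ} (hx : ∀ v ∈ x, v ≤ b)
    (hy : ∀ v ∈ y, v ≤ b) :
    codeSum (x.map (bump b) ++ b :: y.map (bump b)) =
      codeSum (x ++ b :: y) + y.count b := by
  induction x with
  | nil =>
    simp only [List.map_nil, List.nil_append, codeSum]
    rw [codeSum_map_bump hy, filter_congr fun c hc =>
        not_congr (mem_map_bump_of_lt (mem_range.1 hc) y)]
    omega
  | cons v x ih =>
    simp only [List.mem_cons, forall_eq_or_imp] at hx
    rw [List.map_cons, List.cons_append, List.cons_append, codeSum, codeSum, ih hx.2]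
    have key : ∀ c < b, c ∉ x.map (bump b) ++ b :: y.map (bump b) ↔ c ∉ x ++ b :: y := by
      intro c hc
      simp only [List.mem_append, List.mem_cons, mem_map_bump_of_lt hc]
    rcases hx.1.lt_or_eq with hv | rfl
    · rw [bump_of_lt hv, filter_congr fun c hc => key c ((mem_range.1 hc).trans hv)]
      omega
    · rw [bump_self, range_add_one, filter_insert, if_neg (by simp), filter_congr fun c hc =>
        key c (mem_range.1 hc)]
      omega

theorem lt_bump_iff {b n v : ℕ} (h : n < b) : n < bump b v ↔ n < v := by
  unfold bump
  split_ifs <;> omega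

theorem excList_map_bump {b : ℕ} {l : List ℕ} (h : l.length ≤ b) :
    excList (l.map (bump b)) = excList l := by
  induction l with
  | nil => rfl
  | cons v l ih =>
    rw [List.length_cons] at h
    rw [List.map_cons, excList, excList, ih (by omega), List.length_map,
      if_congr (lt_bump_iff (by omega)) rfl rfl]

theorem excList_map_bump_append {b : ℕ} {x y : List ℕ} (h : (x ++ b :: y).length ≤ b) :
    excList (x.map (bump b) ++ b :: y.map (bump b)) = excList (x ++ b :: y) := by
  induction x with
  | nil =>
    simp only [List.nil_append, List.length_cons] at h
    simp only [List.map_nil, List.nil_append, excList, List.length_map]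
    rw [excList_map_bump (by omega)]
  | cons v x ih =>
    rw [List.cons_append, List.length_cons] at h
    rw [List.map_cons, List.cons_append, List.cons_append, excList, excList, ih (by omega)]
    have h' : (x.map (bump b) ++ b :: y.map (bump b)).length = (x ++ b :: y).length := by simp
    rw [h', if_congr (lt_bump_iff (by omega)) rfl rfl]

end PartialWords

section LeftSide

variable {R : Type*} [CommSemiring R]

/-- The weight of a reversed partial word. -/
def codeWeight (q t : R) (f : List ℕ) : R :=
  q ^ (codeSum f - excList f) * t ^ excList f

theorem codeWeight_eq_mul (q t : R) {f g : List ℕ} {k : ℕ} (h : codeSum g = codeSum f + k)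
    (h' : excList g = excList f) : codeWeight q t g = codeWeight q t f * q ^ k := by
  have := excList_le_codeSum f
  rw [codeWeight, codeWeight, h, h', show codeSum f + k - excList f =
    codeSum f - excList f + k by omega, pow_add]
  ring

theorem sum_partialWords_succ_right (q t : R) (b : ℕ) (F : ℕ → R) :
    ∑ f ∈ partialWords b (b + 1), codeWeight q t f * F (f.count (b + 1)) =
      ∑ f ∈ partialWords b b, codeWeight q t f *
        (brk 1 q (f.count b) * F (f.count b - 1) + q ^ f.count b * F (f.count b)) := by
  have hle : ∀ {f : List ℕ}, (∀ v ∈ f.map (bump b), v ≤ b + 1) ↔ ∀ v ∈ f, v ≤ b := by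
    intro f
    simp only [List.mem_map, forall_exists_index, and_imp, forall_apply_eq_imp_iff₂]
    refine forall₂_congr fun v _ => ?_
    unfold bump
    split_ifs <;> omega
  rw [← sum_filter_add_sum_filter_not (partialWords b (b + 1)) (fun f => b ∈ f)]
  simp only [mul_add, sum_add_distrib]
  congr 1
  · have h := sum_allSplits 1 q b (partialWords b b)
      (fun f => codeWeight q t f * F (f.count b - 1))
    simp only [one_pow, one_mul] at h
    rw [sum_congr rfl (fun f _ => show codeWeight q t f * (brk 1 q (f.count b) *
      F (f.count b - 1)) = codeWeight q t f * F (f.count b - 1) * brk 1 q (f.count b) by ring),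
      ← h]
    symm
    refine sum_bij (fun z _ => z.1.map (bump b) ++ b :: z.2.map (bump b)) ?_ ?_ ?_ ?_
    · rintro ⟨x, y⟩ hz
      rw [mem_allSplits, mem_partialWords] at hz
      obtain ⟨h1, h2, h3⟩ := hz
      simp only [mem_filter, mem_partialWords]
      refine ⟨⟨by simpa using h1, fun v hv => ?_, fun c hc => ?_⟩, by simp⟩
      · simp only [List.mem_append, List.mem_cons] at hv h2
        rcases hv with hv | rfl | hv
        · exact hle.2 (fun u hu => h2 u (Or.inl hu)) v hv
        · omega
        · exact hle.2 (fun u hu => h2 u (Or.inr (Or.inr hu))) v hv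
      · rcases (Nat.lt_succ_iff.1 hc).lt_or_eq with hc' | rfl
        · have := h3 c hc'
          rw [List.count_append, List.count_cons_of_ne hc'.ne'] at this ⊢
          rwa [count_map_bump_of_lt hc', count_map_bump_of_lt hc']
        · simp [List.count_append, count_map_bump_self]
    · rintro ⟨x, y⟩ _ ⟨x', y'⟩ _ h
      obtain ⟨rfl, rfl⟩ := map_bump_append_cons_inj h
      rfl
    · intro f hf
      simp only [mem_filter, mem_partialWords] at hf
      obtain ⟨⟨h1, h2, h3⟩, h4⟩ := hf
      obtain ⟨x, y, rfl, hx⟩ := List.eq_append_cons_of_mem h4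
      have hy : b ∉ y := by
        have := h3 b (by omega)
        rw [List.count_append, List.count_cons_self, List.count_eq_zero.2 hx] at this
        exact List.count_eq_zero.1 (by omega)
      obtain ⟨x, rfl⟩ := exists_map_bump hx
      obtain ⟨y, rfl⟩ := exists_map_bump hy
      refine ⟨(x, y), ?_, rfl⟩
      rw [mem_allSplits, mem_partialWords]
      refine ⟨by simpa using h1, ?_, fun c hc => ?_⟩
      · simp only [List.mem_append, List.mem_cons] at h2 ⊢
        rintro v (hv | rfl | hv)
        · exact hle.1 (fun u hu => h2 u (Or.inl hu)) v hv
        · exact le_rfl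
        · exact hle.1 (fun u hu => h2 u (Or.inr (Or.inr hu))) v hv
      · have := h3 c (by omega)
        rw [List.count_append, List.count_cons_of_ne hc.ne'] at this ⊢
        rwa [count_map_bump_of_lt hc, count_map_bump_of_lt hc] at this
    · rintro ⟨x, y⟩ hz
      rw [mem_allSplits, mem_partialWords] at hz
      obtain ⟨h1, h2, h3⟩ := hz
      simp only [List.mem_append, List.mem_cons] at h2
      rw [codeWeight_eq_mul q t (codeSum_map_bump_append (fun v hv => h2 v (Or.inl hv))
        (fun v hv => h2 v (Or.inr (Or.inr hv)))) (excList_map_bump_append h1.le)]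
      simp only [List.count_append, List.count_cons, count_succ_map_bump]
      simp [mul_right_comm]
  · symm
    refine sum_bij (fun f _ => f.map (bump b)) ?_ ?_ ?_ ?_
    · intro f hf
      rw [mem_partialWords] at hf
      obtain ⟨h1, h2, h3⟩ := hf
      simp only [mem_filter, mem_partialWords]
      refine ⟨⟨by simpa using h1, hle.2 h2, fun c hc => ?_⟩, notMem_map_bump b f⟩
      rcases (Nat.lt_succ_iff.1 hc).lt_or_eq with hc' | rfl
      · rw [count_map_bump_of_lt hc']
        exact h3 c hc'
      · simp [count_map_bump_self]
    · intro f _ g _ h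
      exact List.map_injective_iff.2 (bump_injective b) h
    · intro f hf
      simp only [mem_filter, mem_partialWords] at hf
      obtain ⟨⟨h1, h2, h3⟩, h4⟩ := hf
      obtain ⟨f, rfl⟩ := exists_map_bump h4
      refine ⟨f, ?_, rfl⟩
      rw [mem_partialWords]
      refine ⟨by simpa using h1, hle.1 h2, fun c hc => ?_⟩
      have := h3 c (by omega)
      rwa [count_map_bump_of_lt hc] at this
    · intro f hf
      rw [mem_partialWords] at hf
      rw [codeWeight_eq_mul q t (codeSum_map_bump hf.2.1) (excList_map_bump hf.1.le),
        count_succ_map_bump, mul_assoc]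

theorem card_filter_notMem {b : ℕ} {l : List ℕ} (hl : l ∈ partialWords b (b + 1)) :
    #{c ∈ range (b + 1) | c ∉ l} = l.count (b + 1) + 1 := by
  rw [mem_partialWords] at hl
  obtain ⟨h1, h2, h3⟩ := hl
  have hs : ∑ c ∈ range (b + 2), l.count c = l.length := by
    have := Multiset.sum_count_eq_card (s := range (b + 2)) (m := (l : Multiset ℕ))
      (fun v hv => mem_range.2 (Nat.lt_succ_of_le (h2 v hv)))
    simpa using this
  rw [sum_range_succ, h1] at hs
  have hc : #{c ∈ range (b + 1) | c ∉ l} + #{c ∈ range (b + 1) | ¬ c ∉ l} = b + 1 := by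
    rw [card_filter_add_card_filter_not, card_range]
  have hd : #{c ∈ range (b + 1) | ¬ c ∉ l} = ∑ c ∈ range (b + 1), l.count c := by
    rw [card_filter]
    refine sum_congr rfl fun c hc => ?_
    have := h3 c (mem_range.1 hc)
    by_cases h : c ∈ l
    · have := List.count_pos_iff.2 h
      rw [if_pos (not_not.2 h)]
      omega
    · rw [List.count_eq_zero.2 h, if_neg (not_not.2 h)]
  omega

theorem sum_partialWords_succ_left (q t : R) (b : ℕ) (F : ℕ → R) :
    ∑ f ∈ partialWords (b + 1) (b + 1), codeWeight q t f * F (f.count (b + 1)) =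
      ∑ l ∈ partialWords b (b + 1), codeWeight q t l *
        (brk 1 q (l.count (b + 1) + 1) * F (l.count (b + 1)) +
          t * q ^ l.count (b + 1) * F (l.count (b + 1) + 1)) := by
  have h1 : ∀ l ∈ partialWords b (b + 1),
      codeWeight q t l * (brk 1 q (l.count (b + 1) + 1) * F (l.count (b + 1)) +
          t * q ^ l.count (b + 1) * F (l.count (b + 1) + 1)) =
      ∑ v ∈ insert (b + 1) {c ∈ range (b + 1) | c ∉ l},
        codeWeight q t (v :: l) * F ((v :: l).count (b + 1)) := by
    intro l hl
    have hcard := card_filter_notMem hl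
    have hlen := (mem_partialWords.1 hl).1
    have hle := excList_le_codeSum l
    rw [sum_insert (by simp), ← hcard, ← sum_pow_card_lt, mul_add, add_comm, sum_mul, mul_sum]
    congr 1
    · rw [List.count_cons_self, codeWeight, codeWeight, codeSum, excList, hcard, hlen,
        if_pos (Nat.lt_succ_self b), show l.count (b + 1) + 1 + codeSum l - (1 + excList l) =
        (codeSum l - excList l) + l.count (b + 1) by omega, pow_add, pow_add]
      ring
    · refine sum_congr rfl fun v hv => ?_
      rw [mem_filter, mem_range] at hv
      have hset : {c ∈ ({c ∈ range (b + 1) | c ∉ l} : Finset ℕ) | c < v} =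
          {c ∈ range v | c ∉ l} := by
        ext c
        simp only [mem_filter, mem_range]
        have := hv.1
        constructor
        · exact fun h => ⟨h.2, h.1.2⟩
        · exact fun h => ⟨⟨by omega, h.2⟩, h.1⟩
      rw [hset, List.count_cons_of_ne (by omega), codeWeight_eq_mul q t (f := l) (g := v :: l)
        (k := #{c ∈ range v | c ∉ l}) (by rw [codeSum]; omega)
        (by rw [excList, if_neg (by omega), zero_add])]
      ring
  rw [sum_congr rfl h1, sum_sigma']
  symm
  refine sum_bij (fun z _ => z.2 :: z.1) ?_ ?_ ?_ ?_
  · rintro ⟨l, v⟩ hz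
    simp only [mem_sigma, mem_insert, mem_filter, mem_range, mem_partialWords] at hz ⊢
    obtain ⟨⟨h1, h2, h3⟩, h4⟩ := hz
    refine ⟨by simp [h1], ?_, fun c hc => ?_⟩
    · simp only [List.mem_cons, forall_eq_or_imp]
      exact ⟨by omega, h2⟩
    · have := h3 c hc
      rw [List.count_cons]
      by_cases hvc : v = c
      · subst hvc
        have : v ∉ l := by
          rcases h4 with h4 | h4
          · omega
          · exact h4.2
        simp [List.count_eq_zero.2 this]
      · simpa [hvc] using this
  · rintro ⟨l, v⟩ _ ⟨l', v'⟩ _ h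
    simp only [List.cons.injEq] at h
    obtain ⟨rfl, rfl⟩ := h
    rfl
  · intro f hf
    rw [mem_partialWords] at hf
    obtain ⟨h1, h2, h3⟩ := hf
    cases f with
    | nil => simp at h1
    | cons v l =>
      refine ⟨⟨l, v⟩, ?_, rfl⟩
      simp only [mem_sigma, mem_insert, mem_filter, mem_range, mem_partialWords]
      simp only [List.mem_cons, forall_eq_or_imp] at h2
      refine ⟨⟨by simpa using h1, h2.2, fun c hc => ?_⟩, ?_⟩
      · exact List.count_le_count_cons.trans (h3 c hc)
      · by_cases hv : v = b + 1
        · exact Or.inl hv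
        · have hv' : v < b + 1 := by omega
          have := h3 v hv'
          rw [List.count_cons_self] at this
          exact Or.inr ⟨hv', List.count_eq_zero.1 (by omega)⟩
  · intro z _
    rfl

/-- The effect on a weight function of adding one row to a partial permutation. -/
def rowStep (q t : R) (F : ℕ → R) (k : ℕ) : R :=
  brk 1 q (k + 1) * F k + t * q ^ k * F (k + 1)

/-- The effect on a weight function of adding one column to a partial permutation. -/
def colStep (q : R) (F : ℕ → R) (k : ℕ) : R :=
  brk 1 q k * F (k - 1) + q ^ k * F k

theorem sum_partialWords (q t : R) (n : ℕ) (F : ℕ → R) :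
    ∑ f ∈ partialWords n n, codeWeight q t f * F (f.count n) =
      (fun G => colStep q (rowStep q t G))^[n] F 0 := by
  induction n generalizing F with
  | zero =>
    have : partialWords 0 0 = {[]} := by
      ext f
      simp only [mem_partialWords, List.length_eq_zero_iff, mem_singleton]
      exact ⟨fun h => h.1, fun h => by simp [h]⟩
    simp [this, codeWeight, codeSum, excList]
  | succ n ih =>
    rw [sum_partialWords_succ_left]
    have h := sum_partialWords_succ_right q t n (rowStep q t F)
    simp only [rowStep] at h
    rw [h, Function.iterate_succ_apply, ← ih]
    rfl

end LeftSide

section Word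

variable {n : ℕ} (σ : Equiv.Perm (Fin n))

theorem word_succ {i : ℕ} (h : i < n) : word σ (i + 1) = (σ ⟨i, h⟩ : ℕ) + 1 := by
  unfold word
  rw [dif_pos ⟨by omega, by omega⟩]
  rfl

theorem word_mem_Icc {i : ℕ} (h : i ∈ Icc 1 n) : word σ i ∈ Icc 1 n := by
  rw [mem_Icc] at h
  obtain ⟨i, rfl⟩ : ∃ j, i = j + 1 := ⟨i - 1, by omega⟩
  rw [word_succ σ (by omega), mem_Icc]
  omega

theorem word_injOn : Set.InjOn (word σ) (Icc 1 n) := by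
  intro i hi j hj h
  rw [mem_coe, mem_Icc] at hi hj
  obtain ⟨i, rfl⟩ : ∃ k, i = k + 1 := ⟨i - 1, by omega⟩
  obtain ⟨j, rfl⟩ : ∃ k, j = k + 1 := ⟨j - 1, by omega⟩
  rw [word_succ σ (by omega), word_succ σ (by omega)] at h
  have := σ.injective (Fin.ext (Nat.succ_injective h))
  simp only [Fin.mk.injEq] at this
  omega

theorem image_word : (Icc 1 n).image (word σ) = Icc 1 n := by
  refine eq_of_subset_of_card_le ?_ (le_of_eq (card_image_of_injOn (word_injOn σ)).symm)
  intro v hv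
  obtain ⟨i, hi, rfl⟩ := mem_image.1 hv
  exact word_mem_Icc σ hi

theorem word_zero : word σ 0 = 0 := by simp [word]

theorem word_last : word σ (n + 1) = 0 := by simp [word]

/-- The word `σ(1) ⋯ σ(n)` as a list. -/
def wordList : List ℕ := (List.range' 1 n).map (word σ)

theorem length_wordList : (wordList σ).length = n := by simp [wordList]

theorem mem_wordList {v : ℕ} : v ∈ wordList σ ↔ v ∈ Icc 1 n := by
  rw [← image_word σ]
  simp only [wordList, List.mem_map, List.mem_range'_1, mem_image, mem_Icc]
  refine exists_congr fun i => and_congr_left fun _ => ?_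
  omega

theorem nodup_wordList : (wordList σ).Nodup := by
  refine List.Nodup.map_on ?_ (List.nodup_range' ..)
  intro i hi j hj h
  rw [List.mem_range'_1] at hi hj
  exact word_injOn σ (by simp; omega) (by simp; omega) h

theorem wordList_injective : Function.Injective (wordList (n := n)) := by
  intro σ τ h
  ext i
  have := congrArg (fun l => l[(i : ℕ)]?) h
  simp only [wordList, List.getElem?_map, List.getElem?_range' i.2] at this
  simp only [Option.map_some, Option.some.injEq, one_mul, add_comm 1] at this
  rw [word_succ σ i.2, word_succ τ i.2] at this
  simpa using this

theorem exists_wordList_eq {u : List ℕ} (hl : u.length = n) (hu : ∀ v ∈ u, v ∈ Icc 1 n)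
    (hd : u.Nodup) : ∃ σ : Equiv.Perm (Fin n), wordList σ = u := by
  have hb : ∀ i : Fin n, u[i] ∈ Icc 1 n := fun i => hu _ (List.getElem_mem _)
  have hb' : ∀ i : Fin n, u[i] - 1 < n := fun i => by
    have := mem_Icc.1 (hb i)
    omega
  have hinj : Function.Injective fun i : Fin n => (⟨u[i] - 1, hb' i⟩ : Fin n) := by
    intro i j h
    simp only [Fin.mk.injEq] at h
    have h1 := mem_Icc.1 (hb i)
    have h2 := mem_Icc.1 (hb j)
    exact Fin.ext ((hd.getElem_inj_iff).1 (show u[i] = u[j] by omega))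
  refine ⟨Equiv.ofBijective _ (Finite.injective_iff_bijective.1 hinj), ?_⟩
  refine List.ext_getElem (by simp [wordList, hl]) fun i h1 h2 => ?_
  have hi : i < n := by omega
  have := mem_Icc.1 (hb ⟨i, hi⟩)
  simp only [wordList, List.getElem_map, List.getElem_range', one_mul, add_comm 1]
  rw [word_succ _ hi]
  simp only [Equiv.ofBijective_apply, Fin.getElem_fin] at this ⊢
  omega

end Word

section Code

variable {n : ℕ} (σ : Equiv.Perm (Fin n))

/-- The reversed word of a permutation, with values counted from `0`. -/
def revWord : List ℕ := ((wordList σ).map fun v => v - 1).reverse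

theorem revWord_eq :
    revWord σ = ((List.range n).map fun i => word σ (i + 1) - 1).reverse := by
  rw [revWord, wordList, List.range'_eq_map_range]
  simp [List.map_map, Function.comp_def, add_comm]

theorem codeSum_reverse_map_range (g : ℕ → ℕ) (n : ℕ) :
    codeSum ((List.range n).map g).reverse =
      ∑ i ∈ range n, #{c ∈ range (g i) | ∀ j < i, g j ≠ c} := by
  induction n with
  | zero => simp [codeSum]
  | succ n ih =>
    rw [List.range_succ, List.map_append, List.reverse_append, List.map_singleton,
      List.reverse_singleton, List.singleton_append, codeSum, ih, sum_range_succ, add_comm]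
    simp

theorem excList_reverse_map_range (g : ℕ → ℕ) (n : ℕ) :
    excList ((List.range n).map g).reverse = #{i ∈ range n | i < g i} := by
  induction n with
  | zero => simp [excList]
  | succ n ih =>
    rw [List.range_succ, List.map_append, List.reverse_append, List.map_singleton,
      List.reverse_singleton, List.singleton_append, excList, ih, range_add_one, filter_insert]
    split_ifs with h1 h2 h2
    · rw [card_insert_of_notMem (by simp), add_comm]
    · simp at h1; omega
    · simp at h1; omega
    · simp

theorem sum_Icc_one_eq_sum_range {M : Type*} [AddCommMonoid M] (f : ℕ → M) (n : ℕ) :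
    ∑ i ∈ Icc 1 n, f i = ∑ i ∈ range n, f (i + 1) := by
  rw [range_eq_Ico, sum_Ico_add' f 0 n 1, zero_add]
  rfl

theorem excList_revWord : excList (revWord σ) = exc σ := by
  rw [revWord_eq, excList_reverse_map_range, exc, card_filter, card_filter,
    sum_Icc_one_eq_sum_range]
  refine sum_congr rfl fun i _ => if_congr ?_ rfl rfl
  omega

theorem codeSum_revWord : codeSum (revWord σ) = inv σ := by
  rw [revWord_eq, codeSum_reverse_map_range, inv, card_filter, sum_product,
    sum_Icc_one_eq_sum_range]
  refine sum_congr rfl fun i hi => ?_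
  rw [mem_range] at hi
  rw [← card_filter]
  symm
  refine card_bij (fun j _ => word σ j - 1) ?_ ?_ ?_
  · intro j hj
    simp only [mem_filter, mem_range] at hj ⊢
    obtain ⟨hj1, hj2, hj3⟩ := hj
    have h1 := mem_Icc.1 (word_mem_Icc σ hj1)
    refine ⟨by omega, fun k hk h => ?_⟩
    have hk1 : k + 1 ∈ Icc 1 n := mem_Icc.2 ⟨by omega, by omega⟩
    have h2 := mem_Icc.1 (word_mem_Icc σ hk1)
    have := word_injOn σ hk1 hj1 (by omega)
    omega
  · intro j hj k hk h
    simp only [mem_filter] at hj hk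
    have h1 := mem_Icc.1 (word_mem_Icc σ hj.1)
    have h2 := mem_Icc.1 (word_mem_Icc σ hk.1)
    exact word_injOn σ hj.1 hk.1 (by omega)
  · intro c hc
    simp only [mem_filter, mem_range] at hc
    have hi1 := mem_Icc.1 (word_mem_Icc σ (mem_Icc.2 ⟨by omega, by omega⟩ : i + 1 ∈ Icc 1 n))
    have hcm : c + 1 ∈ (Icc 1 n).image (word σ) := by
      rw [image_word, mem_Icc]
      omega
    obtain ⟨j, hj, hjc⟩ := mem_image.1 hcm
    refine ⟨j, ?_, by omega⟩
    have hj' := mem_Icc.1 hj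
    refine mem_filter.2 ⟨hj, ?_, show word σ (i + 1) > word σ j by omega⟩
    rcases lt_trichotomy j (i + 1) with h | h | h
    · exact absurd (show word σ (j - 1 + 1) - 1 = c by
        rw [Nat.sub_add_cancel hj'.1]; omega) (hc.2 (j - 1) (by omega))
    · rw [h] at hjc
      omega
    · exact h

theorem sum_perm_eq_sum_partialWords {R : Type*} [CommSemiring R] (q t : R) (n : ℕ) :
    ∑ σ : Equiv.Perm (Fin n), q ^ (inv σ - exc σ) * t ^ exc σ =
      ∑ f ∈ partialWords n n, codeWeight q t f * (if f.count n = 0 then 1 else 0) := by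
  simp only [mul_ite, mul_one, mul_zero]
  rw [← sum_filter]
  refine sum_bij (fun σ _ => revWord σ) ?_ ?_ ?_ ?_
  · intro σ _
    have hmem : ∀ v ∈ revWord σ, v < n := by
      intro v hv
      simp only [revWord, List.mem_reverse, List.mem_map, mem_wordList, mem_Icc] at hv
      obtain ⟨u, hu, rfl⟩ := hv
      omega
    have hnd : (revWord σ).Nodup := by
      rw [revWord, List.nodup_reverse]
      refine List.Nodup.map_on ?_ (nodup_wordList σ)
      intro u hu v hv h
      simp only [mem_wordList, mem_Icc] at hu hv
      omega
    refine mem_filter.2 ⟨mem_partialWords.2 ⟨?_, fun v hv => (hmem v hv).le, fun c _ => ?_⟩, ?_⟩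
    · simp [revWord, length_wordList]
    · exact List.nodup_iff_count_le_one.1 hnd c
    · exact List.count_eq_zero.2 fun h => lt_irrefl _ (hmem n h)
  · intro σ _ τ _ h
    refine wordList_injective ?_
    rw [revWord, revWord, List.reverse_inj] at h
    have key : ∀ ρ : Equiv.Perm (Fin n),
        ((wordList ρ).map fun v => v - 1).map (· + 1) = wordList ρ := by
      intro ρ
      rw [List.map_map]
      refine (List.map_congr_left fun v hv => ?_).trans (List.map_id _)
      have := mem_Icc.1 ((mem_wordList ρ).1 hv)
      simp only [Function.comp_apply, id]
      omega
    rw [← key σ, h, key]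
  · intro f hf
    rw [mem_filter, mem_partialWords] at hf
    obtain ⟨⟨h1, h2, h3⟩, h4⟩ := hf
    have hlt : ∀ v ∈ f, v < n := fun v hv => lt_of_le_of_ne (h2 v hv) (by
      rintro rfl
      exact List.count_eq_zero.1 h4 hv)
    have hnd : f.Nodup := List.nodup_iff_count_le_one.2 fun c => by
      by_cases hc : c < n
      · exact h3 c hc
      · rw [List.count_eq_zero.2 fun h => hc (hlt c h)]
        omega
    obtain ⟨σ, hσ⟩ := exists_wordList_eq (n := n) (u := f.reverse.map (· + 1)) (by simp [h1])
      (by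
        simp only [List.mem_map, List.mem_reverse, forall_exists_index, and_imp,
          forall_apply_eq_imp_iff₂, mem_Icc]
        intro v hv
        have := hlt v hv
        omega)
      ((List.nodup_reverse.2 hnd).map (add_left_injective 1))
    exact ⟨σ, mem_univ _, by simp [revWord, hσ, Function.comp_def]⟩
  · intro σ _
    rw [codeWeight, codeSum_revWord, excList_revWord]

end Code

section PairCount

/-- The number of pairs of adjacent letters that satisfy a relation. -/
def pairCount (r : ℕ → ℕ → Prop) [DecidableRel r] : List ℕ → ℕ
  | [] => 0
  | [_] => 0
  | a :: b :: l => (if r a b then 1 else 0) + pairCount r (b :: l)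

/-- The number of letters that are smaller than the preceding and larger than the next letter. -/
def ddCount : List ℕ → ℕ
  | [] => 0
  | [_] => 0
  | [_, _] => 0
  | a :: b :: c :: l => (if b < a ∧ c < b then 1 else 0) + ddCount (b :: c :: l)

variable (r : ℕ → ℕ → Prop) [DecidableRel r]

theorem pairCount_append_cons (l s : List ℕ) (a : ℕ) :
    pairCount r (l ++ a :: s) = pairCount r (l ++ [a]) + pairCount r (a :: s) := by
  induction l with
  | nil => simp [pairCount]
  | cons b l ih =>
    cases l with
    | nil => simp [pairCount]
    | cons d l =>
      simp only [List.cons_append, pairCount] at ih ⊢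
      rw [ih]
      omega

theorem pairCount_map (r' : ℕ → ℕ → Prop) [DecidableRel r'] {g : ℕ → ℕ}
    (h : ∀ a b, r (g a) (g b) ↔ r' a b) (l : List ℕ) :
    pairCount r (l.map g) = pairCount r' l := by
  induction l with
  | nil => rfl
  | cons a l ih =>
    cases l with
    | nil => rfl
    | cons b l =>
      simp only [List.map_cons, pairCount, h] at ih ⊢
      rw [ih]

theorem pairCount_cons_congr {u u' : ℕ} (h : ∀ b, r u b ↔ r u' b) (l : List ℕ) :
    pairCount r (u :: l) = pairCount r (u' :: l) := by
  cases l with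
  | nil => rfl
  | cons b l => simp only [pairCount, h]

theorem pairCount_concat_congr {u u' : ℕ} (h : ∀ a, r a u ↔ r a u') (l : List ℕ) :
    pairCount r (l ++ [u]) = pairCount r (l ++ [u']) := by
  induction l with
  | nil => rfl
  | cons a l ih =>
    cases l with
    | nil => simp only [List.cons_append, List.nil_append, pairCount, h]
    | cons b l =>
      simp only [List.cons_append, pairCount] at ih ⊢
      rw [ih]

theorem pairCount_gt_append_of_lt {a b : ℕ} (h : a < b) (A W : List ℕ) :
    pairCount (· > ·) (A ++ a :: b :: W) =
      pairCount (· > ·) (A ++ [a]) + pairCount (· > ·) (b :: W) := by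
  rw [pairCount_append_cons, pairCount, if_neg (by omega), zero_add]

theorem ddCount_append_of_lt {a b : ℕ} (h : a < b) (A W : List ℕ) :
    ddCount (A ++ a :: b :: W) = ddCount (A ++ [a]) + ddCount (b :: W) := by
  have h0 : ddCount (a :: b :: W) = ddCount (b :: W) := by
    cases W with
    | nil => rfl
    | cons e W => rw [ddCount, if_neg (by omega), zero_add]
  induction A with
  | nil => simp [ddCount, h0]
  | cons e A ih =>
    cases A with
    | nil => simp only [List.cons_append, List.nil_append, ddCount, h0]; simp; omega
    | cons f A =>
      cases A with
      | nil =>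
        simp only [List.cons_append, List.nil_append, ddCount] at ih ⊢
        omega
      | cons g A =>
        simp only [List.cons_append, ddCount] at ih ⊢
        omega

theorem ddCount_cons_cons_congr {u u' c : ℕ} (h : c < u) (h' : c < u') (l : List ℕ) :
    ddCount (u :: c :: l) = ddCount (u' :: c :: l) := by
  cases l with
  | nil => rfl
  | cons b l => simp only [ddCount, h, h']

theorem ddCount_map {g : ℕ → ℕ} (h : StrictMono g) (l : List ℕ) :
    ddCount (l.map g) = ddCount l := by
  induction l with
  | nil => rfl
  | cons a l ih =>
    cases l with
    | nil => rfl
    | cons b l =>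
      cases l with
      | nil => rfl
      | cons c l =>
        simp only [List.map_cons, ddCount, h.lt_iff_lt] at ih ⊢
        rw [ih]

end PairCount

section Refine

/-- The list obtained from `x ++ c :: y` when the displayed letter `c` is kept and one or two
letters `c + 1` may be put next to it, while every other `c` becomes `c + 1`. -/
def fillSlot (c : ℕ) (x y : List ℕ) (l r : Bool) : List ℕ :=
  (x.map (bump c) ++ cond l [c + 1] []) ++ c :: (cond r [c + 1] [] ++ y.map (bump c))

theorem pairCount_fillSlot (ρ : ℕ → ℕ → Prop) [DecidableRel ρ] {c : ℕ}
    (hb : ∀ a b, ρ (bump c a) (bump c b) ↔ ρ a b) (h1 : ∀ a, ρ a c ↔ ρ a (c + 1))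
    (h2 : ∀ b, ρ c b ↔ ρ (c + 1) b) (h3 : ¬ ρ c c) (x y : List ℕ) (l r : Bool) :
    pairCount ρ (fillSlot c x y l r) = pairCount ρ (x ++ c :: y) := by
  have h4 : ¬ ρ c (c + 1) := fun h => h3 ((h1 c).2 h)
  have h5 : ¬ ρ (c + 1) c := fun h => h3 ((h2 c).2 h)
  rw [← pairCount_map ρ ρ hb (x ++ c :: y), List.map_append, List.map_cons, bump_self,
    pairCount_append_cons, fillSlot, pairCount_append_cons]
  congr 1
  · cases l
    · simp only [cond_false, List.append_nil]
      exact pairCount_concat_congr ρ h1 _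
    · simp only [cond_true]
      rw [List.append_assoc, List.singleton_append, pairCount_append_cons]
      simp [pairCount, h5]
  · cases r
    · simp only [cond_false, List.nil_append]
      exact pairCount_cons_congr ρ h2 _
    · simp [pairCount, h4]

/-- The number of adjacent pairs that cross `v` downwards to the left of `v`, plus twice the number
of adjacent pairs that cross `v` upwards to the right of `v`. -/
def cross (v : ℕ) (u : List ℕ) : ℕ :=
  pairCount (fun a b => b < v ∧ v < a) (u.takeWhile (· ≠ v)) +
    2 * pairCount (fun a b => a < v ∧ v < b) (u.dropWhile (· ≠ v)).tail

theorem cross_append_cons {v : ℕ} {p : List ℕ} (h : v ∉ p) (s : List ℕ) :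
    cross v (p ++ v :: s) = pairCount (fun a b => b < v ∧ v < a) p +
      2 * pairCount (fun a b => a < v ∧ v < b) s := by
  have hp : ∀ a ∈ p, decide (a ≠ v) = true := fun a ha =>
    decide_eq_true (fun e => h (e ▸ ha))
  rw [cross, List.takeWhile_append_of_pos hp, List.dropWhile_append_of_pos hp]
  simp

theorem bump_lt_iff_of_lt {c v : ℕ} (h : v < c) (a : ℕ) : bump c a < v ↔ a < v := by
  unfold bump
  split_ifs <;> omega

theorem cross_fillSlot_of_lt {c v : ℕ} (hv : v < c) {x y : List ℕ} (h : v ∈ x ++ c :: y)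
    (l r : Bool) : cross v (fillSlot c x y l r) = cross v (x ++ c :: y) := by
  have hdown : ∀ a b, (bump c b < v ∧ v < bump c a) ↔ (b < v ∧ v < a) := fun a b => by
    rw [bump_lt_iff_of_lt hv, lt_bump_iff hv]
  have hup : ∀ a b, (bump c a < v ∧ v < bump c b) ↔ (a < v ∧ v < b) := fun a b => by
    rw [bump_lt_iff_of_lt hv, lt_bump_iff hv]
  by_cases hx : v ∈ x
  · obtain ⟨p, s, rfl, hp⟩ := List.eq_append_cons_of_mem hx
    have hp' : v ∉ p.map (bump c) := by rwa [mem_map_bump_of_lt hv]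
    have e : fillSlot c (p ++ v :: s) y l r = p.map (bump c) ++ v :: fillSlot c s y l r := by
      simp [fillSlot, bump_of_lt hv]
    rw [e, List.append_assoc, List.cons_append, cross_append_cons hp, cross_append_cons hp',
      pairCount_map _ _ hdown, pairCount_fillSlot _ hup]
    all_goals intros; omega
  · have hy : v ∈ y := by
      simp only [List.mem_append, List.mem_cons] at h
      rcases h with h | h | h
      · exact absurd h hx
      · omega
      · exact h
    obtain ⟨p, s, rfl, hp⟩ := List.eq_append_cons_of_mem hy
    have e : fillSlot c x (p ++ v :: s) l r = fillSlot c x p l r ++ v :: s.map (bump c) := by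
      simp [fillSlot, bump_of_lt hv]
    have hp' : v ∉ fillSlot c x p l r := by
      simp only [fillSlot, List.mem_append, List.mem_cons, mem_map_bump_of_lt hv, hx, hp]
      cases l <;> cases r <;> simp <;> omega
    have hp2 : v ∉ x ++ c :: p := by
      simp [hx, hp, hv.ne]
    rw [e, ← List.cons_append, ← List.append_assoc, cross_append_cons hp2, cross_append_cons hp',
      pairCount_map _ _ hup, pairCount_fillSlot _ hdown]
    all_goals intros; omega

/-- No two adjacent letters are equal to `c`. -/
def NonAdj (c : ℕ) (u : List ℕ) : Prop := u.IsChain fun a b => ¬ (a = c ∧ b = c)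

theorem pairCount_down_self {c : ℕ} {x : List ℕ} (hx : ∀ v ∈ x, v ≤ c) (h : NonAdj c (x ++ [c]))
    (l : Bool) :
    pairCount (fun a b => b < c ∧ c < a) (x.map (bump c) ++ cond l [c + 1] []) = x.count c := by
  induction x with
  | nil => cases l <;> simp [pairCount]
  | cons a x ih =>
    simp only [List.mem_cons, forall_eq_or_imp] at hx
    cases x with
    | nil =>
      simp only [NonAdj, List.cons_append, List.nil_append, List.isChain_cons_cons] at h
      have ha : a < c := lt_of_le_of_ne hx.1 (by rintro rfl; simp at h)
      cases l <;> simp [pairCount, bump_of_lt ha, ha.ne]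
    | cons b x =>
      simp only [NonAdj, List.cons_append, List.isChain_cons_cons] at h ih
      have ih := ih hx.2 h.2
      simp only [List.map_cons, List.cons_append, pairCount] at ih ⊢
      have hb := hx.2 b (by simp)
      rw [ih, List.count_cons (b := a)]
      rcases hx.1.lt_or_eq with ha | rfl
      · rw [bump_of_lt ha, if_neg (by omega)]
        simp [ha.ne]
      · have hb' : b < a := by omega
        rw [bump_self, bump_of_lt hb', if_pos (by omega)]
        simp [add_comm]

theorem pairCount_up_self {c : ℕ} {y : List ℕ} (hy : ∀ v ∈ y, v ≤ c) (h : NonAdj c (c :: y))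
    (r : Bool) :
    pairCount (fun a b => a < c ∧ c < b) (cond r [c + 1] [] ++ y.map (bump c)) = y.count c := by
  have key : ∀ (y : List ℕ) (a : ℕ), (∀ v ∈ a :: y, v ≤ c) → NonAdj c (a :: y) →
      pairCount (fun a b => a < c ∧ c < b) ((a :: y).map (bump c)) = y.count c := by
    intro y
    induction y with
    | nil => simp [pairCount]
    | cons b y ih =>
      intro a hy h
      simp only [NonAdj, List.isChain_cons_cons] at h ih
      simp only [List.mem_cons, forall_eq_or_imp] at hy ih
      have ih := ih b hy.2 h.2
      simp only [List.map_cons, pairCount] at ih ⊢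
      rw [ih, List.count_cons]
      rcases hy.2.1.lt_or_eq with hb | rfl
      · rw [bump_of_lt hb, if_neg (by omega)]
        simp [hb.ne]
      · have ha : a < b := by omega
        rw [bump_self, bump_of_lt ha, if_pos (by omega)]
        simp [add_comm]
  cases y with
  | nil => cases r <;> simp [pairCount]
  | cons a y =>
    simp only [NonAdj, List.isChain_cons_cons] at h
    have ha : a ≠ c := fun e => h.1 ⟨trivial, e⟩
    have := key y a hy h.2
    rw [List.count_cons_of_ne ha, ← this]
    cases r <;> simp [pairCount]

theorem cross_fillSlot_self {c : ℕ} {x y : List ℕ} (hx : ∀ v ∈ x, v ≤ c) (hy : ∀ v ∈ y, v ≤ c)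
    (hx' : NonAdj c (x ++ [c])) (hy' : NonAdj c (c :: y)) (l r : Bool) :
    cross c (fillSlot c x y l r) = x.count c + 2 * y.count c := by
  have : c ∉ x.map (bump c) ++ cond l [c + 1] [] := by
    rw [List.mem_append, not_or]
    exact ⟨notMem_map_bump c x, by cases l <;> simp⟩
  rw [fillSlot, cross_append_cons this, pairCount_down_self hx hx', pairCount_up_self hy hy']

theorem exists_concat_of_nonAdj {c : ℕ} (hc : 0 < c) {x : List ℕ} (hx : ∀ v ∈ x, v ≤ c)
    (h : NonAdj c (x ++ [c])) : ∃ A a, a < c ∧ 0 :: x = A ++ [a] := by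
  rcases List.eq_nil_or_concat x with rfl | ⟨A, a, rfl⟩
  · exact ⟨[], 0, hc, rfl⟩
  · refine ⟨0 :: A, a, lt_of_le_of_ne (hx a (by simp)) ?_, by simp⟩
    rintro rfl
    simp [NonAdj, List.isChain_append] at h

theorem exists_cons_of_nonAdj {c : ℕ} (hc : 0 < c) {y : List ℕ} (hy : ∀ v ∈ y, v ≤ c)
    (h : NonAdj c (c :: y)) : ∃ d B, d < c ∧ y ++ [0] = d :: B := by
  cases y with
  | nil => exact ⟨0, [], hc, rfl⟩
  | cons d B =>
    refine ⟨d, B ++ [0], lt_of_le_of_ne (hy d (by simp)) ?_, by simp⟩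
    rintro rfl
    simp [NonAdj] at h

/-- The number of descents of a word that is continued by `0` on both sides. -/
def desPad (u : List ℕ) : ℕ := pairCount (· > ·) (0 :: (u ++ [0]))

/-- The number of double descents of a word that is continued by `0` on both sides. -/
def ddPad (u : List ℕ) : ℕ := ddCount (0 :: (u ++ [0]))

theorem pad_fillSlot {c : ℕ} (hc : 0 < c) (x y : List ℕ) (l r : Bool) :
    0 :: (fillSlot c x y l r ++ [0]) = (((0 :: x).map (bump c)) ++ cond l [c + 1] []) ++
      c :: (cond r [c + 1] [] ++ (y ++ [0]).map (bump c)) := by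
  simp [fillSlot, bump_of_lt hc]

theorem desPad_fillSlot {c : ℕ} (hc : 0 < c) {x y : List ℕ} (hx : ∀ v ∈ x, v ≤ c)
    (hy : ∀ v ∈ y, v ≤ c) (hx' : NonAdj c (x ++ [c])) (hy' : NonAdj c (c :: y)) (l r : Bool) :
    desPad (fillSlot c x y l r) = desPad (x ++ c :: y) + cond l 1 0 := by
  obtain ⟨A, a, ha, hA⟩ := exists_concat_of_nonAdj hc hx hx'
  obtain ⟨d, B, hd, hB⟩ := exists_cons_of_nonAdj hc hy hy'
  have e : 0 :: ((x ++ c :: y) ++ [0]) = A ++ a :: c :: d :: B := by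
    rw [List.append_assoc, List.cons_append, hB, ← List.cons_append, hA]
    simp
  have hmA : pairCount (· > ·) (A.map (bump c) ++ [a]) = pairCount (· > ·) (A ++ [a]) := by
    rw [← pairCount_map (· > ·) (· > ·) (fun _ _ => (bump_strictMono c).lt_iff_lt) (A ++ [a])]
    simp [bump_of_lt ha]
  have hmB : pairCount (· > ·) (d :: B.map (bump c)) = pairCount (· > ·) (d :: B) := by
    rw [← pairCount_map (· > ·) (· > ·) (fun _ _ => (bump_strictMono c).lt_iff_lt) (d :: B)]
    simp [bump_of_lt hd]
  have hd1 : d < c + 1 := by omega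
  rw [desPad, desPad, pad_fillSlot hc, e, hA, hB, pairCount_gt_append_of_lt ha]
  simp only [List.map_append, List.map_cons, List.map_nil, bump_of_lt ha, bump_of_lt hd,
    List.append_assoc]
  cases l <;> cases r <;>
    simp only [cond_true, cond_false, List.nil_append, List.cons_append] <;>
    rw [pairCount_gt_append_of_lt (by omega), hmA] <;>
    simp [pairCount, hmB, hd, hd1] <;> omega

theorem ddPad_fillSlot {c : ℕ} (hc : 0 < c) {x y : List ℕ} (hx : ∀ v ∈ x, v ≤ c)
    (hy : ∀ v ∈ y, v ≤ c) (hx' : NonAdj c (x ++ [c])) (hy' : NonAdj c (c :: y)) (l r : Bool) :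
    ddPad (fillSlot c x y l r) = ddPad (x ++ c :: y) + cond l (cond r 0 1) 0 := by
  obtain ⟨A, a, ha, hA⟩ := exists_concat_of_nonAdj hc hx hx'
  obtain ⟨d, B, hd, hB⟩ := exists_cons_of_nonAdj hc hy hy'
  have e : 0 :: ((x ++ c :: y) ++ [0]) = A ++ a :: c :: d :: B := by
    rw [List.append_assoc, List.cons_append, hB, ← List.cons_append, hA]
    simp
  have hmA : ddCount (A.map (bump c) ++ [a]) = ddCount (A ++ [a]) := by
    rw [← ddCount_map (bump_strictMono c) (A ++ [a])]
    simp [bump_of_lt ha]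
  have hmB : ddCount (c :: d :: B) = ddCount ((c + 1) :: d :: B.map (bump c)) := by
    rw [← ddCount_map (bump_strictMono c) (c :: d :: B)]
    simp [bump_of_lt hd, bump_self]
  have hd1 : d < c + 1 := by omega
  have hmB' := ddCount_cons_cons_congr hd hd1 (B.map (bump c))
  rw [ddPad, ddPad, pad_fillSlot hc, e, hA, hB, ddCount_append_of_lt ha, hmB]
  simp only [List.map_append, List.map_cons, List.map_nil, bump_of_lt ha, bump_of_lt hd,
    List.append_assoc]
  cases l <;> cases r <;>
    simp only [cond_true, cond_false, List.nil_append, List.cons_append] <;>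
    rw [ddCount_append_of_lt (by omega), hmA]
  · rw [hmB', add_zero]
  · simp [ddCount]
  · simp [ddCount, hmB', hd]
    omega
  · rw [show (c + 1) :: c :: (c + 1) :: d :: B.map (bump c) =
      [c + 1] ++ c :: (c + 1) :: d :: B.map (bump c) from rfl,
      ddCount_append_of_lt (Nat.lt_succ_self c)]
    simp [ddCount]

end Refine

section SlotWords

theorem nonAdj_map_bump {c : ℕ} {u : List ℕ} : NonAdj (c + 1) (u.map (bump c)) ↔ NonAdj c u := by
  have : ∀ a, bump c a = c + 1 ↔ a = c := fun a => by
    rw [← bump_self c]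
    exact (bump_injective c).eq_iff
  simp only [NonAdj, List.isChain_map, this]

theorem nonAdj_append_cons {c : ℕ} {x y : List ℕ} {a : ℕ} :
    NonAdj c (x ++ a :: y) ↔ NonAdj c (x ++ [a]) ∧ NonAdj c (a :: y) := List.isChain_split

theorem nonAdj_concat {c a : ℕ} (h : a ≠ c) {x : List ℕ} :
    NonAdj c (x ++ [a]) ↔ NonAdj c x := by
  simp [NonAdj, List.isChain_append, h]

theorem nonAdj_cons {c a : ℕ} (h : a ≠ c) {x : List ℕ} : NonAdj c (a :: x) ↔ NonAdj c x := by
  simp [NonAdj, List.isChain_cons, h]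

theorem not_nonAdj_concat_concat {c : ℕ} {x : List ℕ} : ¬ NonAdj c ((x ++ [c]) ++ [c]) := by
  simp [NonAdj]

theorem not_nonAdj_cons_cons {c : ℕ} {x : List ℕ} : ¬ NonAdj c (c :: c :: x) := by
  simp [NonAdj]

theorem nonAdj_left_fill {c : ℕ} {x : List ℕ} (h : NonAdj c (x ++ [c])) (l : Bool) :
    NonAdj (c + 1) (x.map (bump c) ++ cond l [c + 1] []) := by
  cases l
  · rw [cond_false, List.append_nil, nonAdj_map_bump]
    exact List.IsChain.left_of_append h
  · rw [← nonAdj_map_bump] at h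
    simpa [bump_self] using h

theorem nonAdj_right_fill {c : ℕ} {y : List ℕ} (h : NonAdj c (c :: y)) (r : Bool) :
    NonAdj (c + 1) (cond r [c + 1] [] ++ y.map (bump c)) := by
  cases r
  · rw [cond_false, List.nil_append, nonAdj_map_bump]
    exact List.IsChain.tail h
  · rw [← nonAdj_map_bump] at h
    simpa [bump_self] using h

theorem exists_left_fill {c : ℕ} {x' : List ℕ} (hc : c ∉ x') (h : NonAdj (c + 1) x') :
    ∃ x l, x' = x.map (bump c) ++ cond l [c + 1] [] ∧ NonAdj c (x ++ [c]) := by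
  obtain ⟨x, rfl⟩ := exists_map_bump hc
  rw [nonAdj_map_bump] at h
  rcases List.eq_nil_or_concat x with rfl | ⟨A, a, rfl⟩
  · exact ⟨[], false, by simp, by simp [NonAdj]⟩
  · rw [List.concat_eq_append] at h ⊢
    by_cases ha : a = c
    · subst ha
      exact ⟨A, true, by simp [bump_self], h⟩
    · refine ⟨A ++ [a], false, by simp, ?_⟩
      rw [List.append_assoc, List.singleton_append, nonAdj_append_cons]
      exact ⟨h, by simp [NonAdj, ha]⟩

theorem exists_right_fill {c : ℕ} {y' : List ℕ} (hc : c ∉ y') (h : NonAdj (c + 1) y') :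
    ∃ y r, y' = cond r [c + 1] [] ++ y.map (bump c) ∧ NonAdj c (c :: y) := by
  obtain ⟨y, rfl⟩ := exists_map_bump hc
  rw [nonAdj_map_bump] at h
  cases y with
  | nil => exact ⟨[], false, by simp, by simp [NonAdj]⟩
  | cons a A =>
    by_cases ha : a = c
    · subst ha
      exact ⟨A, true, by simp [bump_self], h⟩
    · refine ⟨a :: A, false, by simp, ?_⟩
      simp only [NonAdj, List.isChain_cons_cons] at h ⊢
      exact ⟨fun e => ha e.2, h⟩

theorem left_fill_inj {c : ℕ} {x x' : List ℕ} {l l' : Bool} (h : NonAdj c (x ++ [c]))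
    (h' : NonAdj c (x' ++ [c])) (e : x.map (bump c) ++ cond l [c + 1] [] =
      x'.map (bump c) ++ cond l' [c + 1] []) : x = x' ∧ l = l' := by
  have hinj := List.map_injective_iff.2 (bump_injective c)
  have hs : ∀ z : List ℕ, z.map (bump c) ++ [c + 1] = (z ++ [c]).map (bump c) := fun z => by
    simp [bump_self]
  cases l <;> cases l' <;> simp only [cond_true, cond_false, List.append_nil, hs] at e
  · exact ⟨hinj e, rfl⟩
  · rw [hinj e] at h
    exact absurd h not_nonAdj_concat_concat
  · rw [← hinj e] at h'
    exact absurd h' not_nonAdj_concat_concat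
  · exact ⟨List.append_cancel_right (hinj e), rfl⟩

theorem right_fill_inj {c : ℕ} {y y' : List ℕ} {r r' : Bool} (h : NonAdj c (c :: y))
    (h' : NonAdj c (c :: y')) (e : cond r [c + 1] [] ++ y.map (bump c) =
      cond r' [c + 1] [] ++ y'.map (bump c)) : y = y' ∧ r = r' := by
  have hinj := List.map_injective_iff.2 (bump_injective c)
  have hs : ∀ z : List ℕ, (c + 1) :: z.map (bump c) = (c :: z).map (bump c) := fun z => by
    simp [bump_self]
  cases r <;> cases r' <;>
    simp only [cond_true, cond_false, List.nil_append, List.singleton_append, hs] at e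
  · exact ⟨hinj e, rfl⟩
  · rw [hinj e] at h
    exact absurd h not_nonAdj_cons_cons
  · rw [← hinj e] at h'
    exact absurd h' not_nonAdj_cons_cons
  · exact ⟨(List.cons.inj (hinj e)).2, rfl⟩

theorem notMem_left_fill (c : ℕ) (x : List ℕ) (l : Bool) :
    c ∉ x.map (bump c) ++ cond l [c + 1] [] := by
  rw [List.mem_append, not_or]
  exact ⟨notMem_map_bump c x, by cases l <;> simp⟩

theorem notMem_right_fill (c : ℕ) (y : List ℕ) (r : Bool) :
    c ∉ cond r [c + 1] [] ++ y.map (bump c) := by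
  rw [List.mem_append, not_or]
  exact ⟨by cases r <;> simp, notMem_map_bump c y⟩

theorem fillSlot_inj {c : ℕ} {x x' y y' : List ℕ} {l l' r r' : Bool}
    (h : NonAdj c (x ++ c :: y)) (h' : NonAdj c (x' ++ c :: y'))
    (e : fillSlot c x y l r = fillSlot c x' y' l' r') : ((x, y), l, r) = ((x', y'), l', r') := by
  rw [nonAdj_append_cons] at h h'
  obtain ⟨e1, -, e2⟩ := (List.append_cons_inj_of_notMem (notMem_left_fill c x l)
    (notMem_right_fill c y r)).1 e
  obtain ⟨rfl, rfl⟩ := left_fill_inj h.1 h'.1 e1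
  obtain ⟨rfl, rfl⟩ := right_fill_inj h.2 h'.2 e2
  rfl

theorem count_fillSlot_of_lt {c v : ℕ} (hv : v < c) (x y : List ℕ) (l r : Bool) :
    (fillSlot c x y l r).count v = (x ++ c :: y).count v := by
  have h : c ≠ v := hv.ne'
  have h' : c + 1 ≠ v := by omega
  cases l <;> cases r <;>
    simp [fillSlot, List.count_append, count_map_bump_of_lt hv, h, h']

theorem count_fillSlot_self (c : ℕ) (x y : List ℕ) (l r : Bool) :
    (fillSlot c x y l r).count c = 1 := by
  cases l <;> cases r <;>
    simp [fillSlot, List.count_append, count_map_bump_self]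

theorem count_succ_fillSlot (c : ℕ) (x y : List ℕ) (l r : Bool) :
    (fillSlot c x y l r).count (c + 1) = x.count c + y.count c + cond l 1 0 + cond r 1 0 := by
  cases l <;> cases r <;>
    simp [fillSlot, List.count_append, count_succ_map_bump] <;> omega

/-- A nonempty word in which each of `1, …, m` occurs once and all other letters are `m + 1`, no
two of these being adjacent. The letters `m + 1` stand for blocks of letters above `m`. -/
structure IsSlotWord (m : ℕ) (u : List ℕ) : Prop where
  ne_nil : u ≠ []
  mem_bounds : ∀ v ∈ u, 1 ≤ v ∧ v ≤ m + 1
  count_eq_one : ∀ v, 1 ≤ v → v ≤ m → u.count v = 1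
  nonAdj : NonAdj (m + 1) u

theorem bump_bounds {c v : ℕ} (hc : 0 < c) : (1 ≤ bump c v ∧ bump c v ≤ c + 1) ↔ 1 ≤ v ∧ v ≤ c := by
  unfold bump
  split_ifs <;> omega

theorem mem_bounds_fillSlot {c : ℕ} (hc : 0 < c) {x y : List ℕ} {l r : Bool} :
    (∀ v ∈ fillSlot c x y l r, 1 ≤ v ∧ v ≤ c + 1) ↔ ∀ v ∈ x ++ c :: y, 1 ≤ v ∧ v ≤ c := by
  have h1 : ∀ s : Bool, ∀ v ∈ (cond s [c + 1] [] : List ℕ), 1 ≤ v ∧ v ≤ c + 1 := by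
    intro s v hv
    cases s <;> simp at hv
    omega
  simp only [fillSlot, List.forall_mem_append, List.forall_mem_cons, List.forall_mem_map,
    bump_bounds hc]
  have hc1 : 1 ≤ c ∧ c ≤ c + 1 := by omega
  have hc2 : 1 ≤ c ∧ c ≤ c := by omega
  exact ⟨fun h => ⟨h.1.1, hc2, h.2.2.2⟩, fun h => ⟨⟨h.1, h1 l⟩, hc1, h1 r, h.2.2⟩⟩

theorem isSlotWord_fillSlot {m : ℕ} {x y : List ℕ} (l r : Bool)
    (h : IsSlotWord m (x ++ (m + 1) :: y)) :
    IsSlotWord (m + 1) (fillSlot (m + 1) x y l r) := by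
  obtain ⟨h0, h1, h2, h3⟩ := h
  rw [nonAdj_append_cons] at h3
  refine ⟨by simp [fillSlot], (mem_bounds_fillSlot (by omega)).2 h1, fun v hv1 hv2 => ?_, ?_⟩
  · rcases hv2.lt_or_eq with hv | rfl
    · rw [count_fillSlot_of_lt hv, h2 v hv1 (by omega)]
    · exact count_fillSlot_self _ _ _ _ _
  · rw [fillSlot, nonAdj_append_cons, nonAdj_concat (by omega), nonAdj_cons (by omega)]
    exact ⟨nonAdj_left_fill h3.1 l, nonAdj_right_fill h3.2 r⟩

theorem IsSlotWord.exists_fillSlot {m : ℕ} {u : List ℕ} (h : IsSlotWord (m + 1) u) :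
    ∃ x y l r, u = fillSlot (m + 1) x y l r ∧ IsSlotWord m (x ++ (m + 1) :: y) := by
  obtain ⟨h0, h1, h2, h3⟩ := h
  have hcount := h2 (m + 1) (by omega) le_rfl
  obtain ⟨x', y', rfl, hx'⟩ := List.eq_append_cons_of_mem
    (List.count_pos_iff.1 (by omega : 0 < u.count (m + 1)))
  have hy' : m + 1 ∉ y' := by
    rw [List.count_append, List.count_cons_self, List.count_eq_zero.2 hx'] at hcount
    exact List.count_eq_zero.1 (by omega)
  rw [nonAdj_append_cons, nonAdj_concat (by omega), nonAdj_cons (by omega)] at h3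
  obtain ⟨x, l, rfl, hx⟩ := exists_left_fill hx' h3.1
  obtain ⟨y, r, rfl, hy⟩ := exists_right_fill hy' h3.2
  refine ⟨x, y, l, r, rfl, by simp, (mem_bounds_fillSlot (l := l) (r := r) (by omega)).1 h1,
    fun v hv1 hv2 => ?_, nonAdj_append_cons.2 ⟨hx, hy⟩⟩
  rw [← count_fillSlot_of_lt (by omega) x y l r]
  exact h2 v hv1 (by omega)

/-- The set of all words with `IsSlotWord m`. -/
def slotWords : ℕ → Finset (List ℕ)
  | 0 => {[1]}
  | m + 1 => (allSplits (m + 1) (slotWords m) ×ˢ (univ : Finset (Bool × Bool))).image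
      fun z => fillSlot (m + 1) z.1.1 z.1.2 z.2.1 z.2.2

theorem mem_slotWords {m : ℕ} {u : List ℕ} : u ∈ slotWords m ↔ IsSlotWord m u := by
  induction m generalizing u with
  | zero =>
    rw [slotWords, mem_singleton]
    constructor
    · rintro rfl
      exact ⟨by simp, by simp, by intros; omega, by simp [NonAdj]⟩
    · rintro ⟨h0, h1, -, h3⟩
      match u, h0, h1, h3 with
      | [a], _, h1, _ =>
        have := h1 a (by simp)
        rw [show a = 1 by omega]
      | a :: b :: l, _, h1, h3 =>
        have ha := h1 a (by simp)
        have hb := h1 b (by simp)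
        simp only [NonAdj, List.isChain_cons_cons] at h3
        omega
  | succ m ih =>
    simp only [slotWords, mem_image, mem_product, mem_allSplits, mem_univ, and_true, Prod.exists,
      ih]
    constructor
    · rintro ⟨x, y, l, r, h, rfl⟩
      exact isSlotWord_fillSlot l r h
    · intro h
      obtain ⟨x, y, l, r, rfl, h'⟩ := h.exists_fillSlot
      exact ⟨x, y, l, r, h', rfl⟩

theorem sum_slotWords_succ {R : Type*} [CommSemiring R] (m : ℕ) (G : List ℕ → R) :
    ∑ u ∈ slotWords (m + 1), G u = ∑ z ∈ allSplits (m + 1) (slotWords m),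
      ∑ s : Bool × Bool, G (fillSlot (m + 1) z.1 z.2 s.1 s.2) := by
  rw [slotWords, sum_image, sum_product]
  rintro ⟨⟨x, y⟩, l, r⟩ h ⟨⟨x', y'⟩, l', r'⟩ h' e
  simp only [coe_product, Set.mem_prod, mem_coe, mem_allSplits, mem_slotWords] at h h'
  exact fillSlot_inj h.1.nonAdj h'.1.nonAdj e

end SlotWords

section RightSide

/-- The sum of `cross v` over the letters `v = 1, …, m`. -/
def totalCross (m : ℕ) (u : List ℕ) : ℕ := ∑ v ∈ Icc 1 m, cross v u

theorem totalCross_fillSlot {m : ℕ} {x y : List ℕ} (h : IsSlotWord m (x ++ (m + 1) :: y))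
    (l r : Bool) : totalCross (m + 1) (fillSlot (m + 1) x y l r) =
      totalCross m (x ++ (m + 1) :: y) + (x.count (m + 1) + 2 * y.count (m + 1)) := by
  have h3 := nonAdj_append_cons.1 h.nonAdj
  have h1 := h.mem_bounds
  simp only [List.forall_mem_append, List.forall_mem_cons] at h1
  rw [totalCross, totalCross, sum_Icc_succ_top (by omega), cross_fillSlot_self
    (fun v hv => (h1.1 v hv).2) (fun v hv => (h1.2.2 v hv).2) h3.1 h3.2]
  congr 1
  refine sum_congr rfl fun v hv => ?_
  rw [mem_Icc] at hv
  refine cross_fillSlot_of_lt (by omega) (List.count_pos_iff.1 ?_) l r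
  rw [h.count_eq_one v hv.1 hv.2]
  exact one_pos

theorem IsSlotWord.desPad_fillSlot {m : ℕ} {x y : List ℕ} (h : IsSlotWord m (x ++ (m + 1) :: y))
    (l r : Bool) : desPad (fillSlot (m + 1) x y l r) =
      desPad (x ++ (m + 1) :: y) + cond l 1 0 := by
  have h3 := nonAdj_append_cons.1 h.nonAdj
  have h1 := h.mem_bounds
  simp only [List.forall_mem_append, List.forall_mem_cons] at h1
  exact PermStat.desPad_fillSlot (by omega) (fun v hv => (h1.1 v hv).2)
    (fun v hv => (h1.2.2 v hv).2) h3.1 h3.2 l r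

theorem IsSlotWord.ddPad_fillSlot {m : ℕ} {x y : List ℕ} (h : IsSlotWord m (x ++ (m + 1) :: y))
    (l r : Bool) : ddPad (fillSlot (m + 1) x y l r) =
      ddPad (x ++ (m + 1) :: y) + cond l (cond r 0 1) 0 := by
  have h3 := nonAdj_append_cons.1 h.nonAdj
  have h1 := h.mem_bounds
  simp only [List.forall_mem_append, List.forall_mem_cons] at h1
  exact PermStat.ddPad_fillSlot (by omega) (fun v hv => (h1.1 v hv).2)
    (fun v hv => (h1.2.2 v hv).2) h3.1 h3.2 l r

theorem IsSlotWord.desPad_bounds {m : ℕ} {u : List ℕ} (h : IsSlotWord m u) :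
    1 ≤ desPad u ∧ 2 * desPad u ≤ m + u.count (m + 1) + 1 + ddPad u := by
  induction m generalizing u with
  | zero =>
    rw [← mem_slotWords, slotWords, mem_singleton] at h
    subst h
    decide
  | succ m ih =>
    obtain ⟨x, y, l, r, rfl, h'⟩ := h.exists_fillSlot
    have := ih h'
    rw [h'.desPad_fillSlot, h'.ddPad_fillSlot, count_succ_fillSlot]
    rw [List.count_append, List.count_cons_self] at this
    cases l <;> cases r <;> simp only [cond_true, cond_false] <;> omega

variable {R : Type*} [CommSemiring R]

/-- The weight of a word with `m` letters in place; it vanishes if there are double descents. -/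
def slotWeight (q X Y : R) (m : ℕ) (u : List ℕ) : R :=
  if ddPad u = 0 then
    q ^ totalCross m u * (X ^ (desPad u - 1) * Y ^ (m + u.count (m + 1) + 1 - 2 * desPad u))
  else 0

theorem sum_slotWeight_fillSlot (q X Y : R) (F : ℕ → R) {m : ℕ} {x y : List ℕ}
    (h : IsSlotWord m (x ++ (m + 1) :: y)) :
    ∑ s : Bool × Bool, slotWeight q X Y (m + 1) (fillSlot (m + 1) x y s.1 s.2) *
        F ((fillSlot (m + 1) x y s.1 s.2).count (m + 2)) =
      slotWeight q X Y m (x ++ (m + 1) :: y) *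
        (F ((x ++ (m + 1) :: y).count (m + 1) - 1) + Y * F ((x ++ (m + 1) :: y).count (m + 1)) +
          X * F ((x ++ (m + 1) :: y).count (m + 1) + 1)) *
        (q ^ x.count (m + 1) * (q ^ 2) ^ y.count (m + 1)) := by
  have hb := h.desPad_bounds
  have hk : (x ++ (m + 1) :: y).count (m + 1) = x.count (m + 1) + y.count (m + 1) + 1 := by
    rw [List.count_append, List.count_cons_self, add_assoc]
  rw [hk] at hb
  simp only [Fintype.sum_prod_type, Fintype.sum_bool, slotWeight, h.desPad_fillSlot,
    h.ddPad_fillSlot, totalCross_fillSlot h, count_succ_fillSlot, cond_true, cond_false, hk]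
  generalize desPad (x ++ (m + 1) :: y) = D at hb ⊢
  generalize ddPad (x ++ (m + 1) :: y) = d at hb ⊢
  generalize x.count (m + 1) = i at hb ⊢
  generalize y.count (m + 1) = j at hb ⊢
  by_cases hd : d = 0
  · subst hd
    obtain ⟨D, rfl⟩ : ∃ e, D = e + 1 := ⟨D - 1, by omega⟩
    obtain ⟨g, hg⟩ : ∃ g, m + (i + j + 1) + 1 = 2 * (D + 1) + g :=
      ⟨m + (i + j + 1) + 1 - 2 * (D + 1), by omega⟩
    simp only [add_zero, if_true, zero_add, one_ne_zero, if_false, zero_mul]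
    rw [show m + 1 + (i + j + 1 + 1) + 1 - 2 * (D + 1 + 1) = g by omega,
      show m + 1 + (i + j + 1) + 1 - 2 * (D + 1) = g + 1 by omega,
      show m + 1 + (i + j) + 1 - 2 * (D + 1) = g by omega,
      show m + (i + j + 1) + 1 - 2 * (D + 1) = g by omega]
    simp only [Nat.add_sub_cancel, pow_add, pow_one, pow_mul]
    ring
  · simp [hd]

/-- The effect on a weight function of placing the next letter of a word without double
descents. -/
def slotStep (q X Y : R) (F : ℕ → R) (k : ℕ) : R :=
  brk q (q ^ 2) k * (F (k - 1) + Y * F k + X * F (k + 1))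

theorem sum_slotWords (q X Y : R) (n : ℕ) (F : ℕ → R) :
    ∑ u ∈ slotWords n, slotWeight q X Y n u * F (u.count (n + 1)) =
      (slotStep q X Y)^[n] F 1 := by
  induction n generalizing F with
  | zero =>
    have h1 : ddPad [1] = 0 := by decide
    have h2 : desPad [1] = 1 := by decide
    simp [slotWords, slotWeight, totalCross, h1, h2]
  | succ m ih =>
    rw [sum_slotWords_succ, Function.iterate_succ_apply, ← ih]
    rw [sum_congr rfl fun z hz => sum_slotWeight_fillSlot q X Y F
      (mem_slotWords.1 (mem_allSplits.1 hz))]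
    rw [sum_allSplits q (q ^ 2) (m + 1) (slotWords m) (fun u => slotWeight q X Y m u *
      (F (u.count (m + 1) - 1) + Y * F (u.count (m + 1)) + X * F (u.count (m + 1) + 1)))]
    refine sum_congr rfl fun u _ => ?_
    rw [slotStep]
    ring

end RightSide

section WordStatistics

theorem pairCount_map_range' (r : ℕ → ℕ → Prop) [DecidableRel r] (g : ℕ → ℕ) (a k : ℕ) :
    pairCount r ((List.range' a k).map g) =
      ∑ i ∈ Ico a (a + k - 1), if r (g i) (g (i + 1)) then 1 else 0 := by
  induction k generalizing a with
  | zero => rw [Ico_eq_empty (by omega)]; rfl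
  | succ k ih =>
    cases k with
    | zero => rw [Ico_eq_empty (by omega)]; rfl
    | succ k =>
      have := ih (a + 1)
      rw [sum_eq_sum_Ico_succ_bot (by omega), show a + (k + 1 + 1) - 1 = a + 1 + (k + 1) - 1 by
        omega, ← this]
      rfl

theorem ddCount_map_range' (g : ℕ → ℕ) (a k : ℕ) :
    ddCount ((List.range' a k).map g) = ∑ i ∈ Ico a (a + k - 2),
      if g (i + 1) < g i ∧ g (i + 2) < g (i + 1) then 1 else 0 := by
  induction k generalizing a with
  | zero => rw [Ico_eq_empty (by omega)]; rfl
  | succ k ih =>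
    match k with
    | 0 => rw [Ico_eq_empty (by omega)]; rfl
    | 1 => rw [Ico_eq_empty (by omega)]; rfl
    | k + 2 =>
      have := ih (a + 1)
      rw [sum_eq_sum_Ico_succ_bot (by omega), show a + (k + 2 + 1) - 2 = a + 1 + (k + 2) - 2 by
        omega, ← this]
      rfl

variable {n : ℕ} (σ : Equiv.Perm (Fin n))

theorem pad_wordList : 0 :: (wordList σ ++ [0]) = (List.range' 0 (n + 2)).map (word σ) := by
  rw [List.range'_succ, List.map_cons, word_zero, zero_add, List.range'_1_concat, List.map_append,
    List.map_singleton, add_comm 1 n, word_last, wordList]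

theorem desPad_wordList (hn : 1 ≤ n) : desPad (wordList σ) = des σ + 1 := by
  obtain ⟨n, rfl⟩ : ∃ m, n = m + 1 := ⟨n - 1, by omega⟩
  have h1 := mem_Icc.1 (word_mem_Icc σ (mem_Icc.2 ⟨by omega, le_rfl⟩ : n + 1 ∈ Icc 1 (n + 1)))
  have h2 := word_last σ
  rw [desPad, pad_wordList, pairCount_map_range', des, card_filter,
    show 0 + (n + 1 + 2) - 1 = n + 1 + 1 by omega, sum_eq_sum_Ico_succ_bot (by omega),
    sum_Ico_succ_top (by omega), word_zero, if_neg (by omega), if_pos (by omega), zero_add]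
  rfl

theorem ddPad_wordList : ddPad (wordList σ) = dd σ := by
  rw [ddPad, pad_wordList, ddCount_map_range', dd, card_filter, sum_Icc_one_eq_sum_range,
    range_eq_Ico, show 0 + (n + 2) - 2 = n by omega]
  rfl

theorem wordList_eq_append {j : ℕ} (hj : j ∈ Icc 1 n) :
    wordList σ = (List.range' 1 (j - 1)).map (word σ) ++
      word σ j :: (List.range' (j + 1) (n - j)).map (word σ) := by
  rw [mem_Icc] at hj
  rw [wordList, ← List.map_cons, ← List.map_append, ← List.range'_succ]
  congr 1
  have := List.range'_append (s := 1) (m := j - 1) (n := n - j + 1) (step := 1)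
  rw [show 1 + 1 * (j - 1) = j by omega, show j - 1 + (n - j + 1) = n by omega] at this
  exact this.symm

theorem cross_wordList {j : ℕ} (hj : j ∈ Icc 1 n) :
    cross (word σ j) (wordList σ) =
      #{i ∈ Icc 2 n | i < j ∧ word σ (i - 1) > word σ j ∧ word σ j > word σ i} +
      2 * #{i ∈ Icc 1 n | j < i ∧ word σ i > word σ j ∧ word σ j > word σ (i - 1)} := by
  have hnot : word σ j ∉ (List.range' 1 (j - 1)).map (word σ) := by
    intro h
    obtain ⟨i, hi, e⟩ := List.mem_map.1 h
    rw [List.mem_range'_1] at hi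
    rw [mem_Icc] at hj
    have := word_injOn σ (by simp; omega) (by simp; omega) e
    omega
  rw [wordList_eq_append σ hj, cross_append_cons hnot, pairCount_map_range',
    pairCount_map_range', ← card_filter, ← card_filter]
  rw [mem_Icc] at hj
  congr 1
  · refine card_nbij' (· + 1) (· - 1) ?_ ?_ ?_ ?_
    · intro i hi
      simp only [coe_filter, mem_Ico, mem_Icc, Set.mem_ofPred_eq, Nat.add_sub_cancel] at hi ⊢
      omega
    · intro i hi
      simp only [coe_filter, mem_Ico, mem_Icc, Set.mem_ofPred_eq] at hi ⊢
      rw [show i - 1 + 1 = i by omega]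
      omega
    · intro i _
      simp
    · intro i hi
      simp only [coe_filter, mem_Icc, Set.mem_ofPred_eq] at hi
      simp only
      omega
  · congr 1
    refine card_nbij' (· + 1) (· - 1) ?_ ?_ ?_ ?_
    · intro i hi
      simp only [coe_filter, mem_Ico, mem_Icc, Set.mem_ofPred_eq, Nat.add_sub_cancel] at hi ⊢
      omega
    · intro i hi
      simp only [coe_filter, mem_Ico, mem_Icc, Set.mem_ofPred_eq] at hi ⊢
      rw [show i - 1 + 1 = i by omega]
      have : i - 1 ≠ j := by
        rintro rfl
        omega
      omega
    · intro i _
      simp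
    · intro i hi
      simp only [coe_filter, mem_Icc, Set.mem_ofPred_eq] at hi
      simp only
      omega

theorem pat31_2_eq_sum : pat31_2 σ = ∑ j ∈ Icc 1 n,
    #{i ∈ Icc 2 n | i < j ∧ word σ (i - 1) > word σ j ∧ word σ j > word σ i} := by
  rw [pat31_2, card_filter, sum_product_right]
  simp only [← card_filter]
  refine sum_subset (Icc_subset_Icc (by omega) le_rfl) fun j hj hj' => ?_
  rw [card_eq_zero, filter_eq_empty_iff]
  intro i hi h
  simp only [mem_Icc] at hi hj hj'
  omega

theorem pat2_13_eq_sum : pat2_13 σ = ∑ j ∈ Icc 1 n,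
    #{i ∈ Icc 1 n | j < i ∧ word σ i > word σ j ∧ word σ j > word σ (i - 1)} := by
  rw [pat2_13, card_filter, sum_product]
  simp only [← card_filter]

theorem totalCross_wordList : totalCross n (wordList σ) = 2 * pat2_13 σ + pat31_2 σ := by
  rw [totalCross]
  conv_lhs => rw [← image_word σ]
  rw [sum_image (word_injOn σ), sum_congr rfl fun j hj => cross_wordList σ hj, sum_add_distrib,
    ← mul_sum, ← pat31_2_eq_sum, ← pat2_13_eq_sum, add_comm]

theorem isSlotWord_wordList (hn : 1 ≤ n) : IsSlotWord n (wordList σ) := by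
  refine ⟨?_, fun v hv => ?_, fun v h1 h2 => ?_, ?_⟩
  · intro h
    have := length_wordList σ
    rw [h, List.length_nil] at this
    omega
  · have := mem_Icc.1 ((mem_wordList σ).1 hv)
    omega
  · exact List.count_eq_one_of_mem (nodup_wordList σ)
      ((mem_wordList σ).2 (mem_Icc.2 ⟨h1, h2⟩))
  · refine List.Pairwise.isChain (List.pairwise_of_forall_mem_list fun a ha b _ h => ?_)
    have := mem_Icc.1 ((mem_wordList σ).1 ha)
    omega

theorem count_wordList_succ : (wordList σ).count (n + 1) = 0 := by
  rw [List.count_eq_zero, mem_wordList, mem_Icc]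
  omega

theorem slotWeight_wordList {R : Type*} [CommSemiring R] (q X Y : R) (hn : 1 ≤ n) :
    slotWeight q X Y n (wordList σ) = if dd σ = 0 then
      q ^ (2 * pat2_13 σ + pat31_2 σ) * (X ^ des σ * Y ^ (n - 1 - 2 * des σ)) else 0 := by
  rw [slotWeight, ddPad_wordList, desPad_wordList σ hn, totalCross_wordList, count_wordList_succ,
    Nat.add_sub_cancel, show n + 0 + 1 - 2 * (des σ + 1) = n - 1 - 2 * des σ by omega]

theorem two_mul_des_le (hn : 1 ≤ n) (h : dd σ = 0) : 2 * des σ ≤ n - 1 := by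
  have := (isSlotWord_wordList σ hn).desPad_bounds.2
  rw [desPad_wordList σ hn, ddPad_wordList, count_wordList_succ, h] at this
  omega

theorem sum_perm_eq_sum_slotWords {R : Type*} [CommSemiring R] (q X Y : R) {n : ℕ} (hn : 1 ≤ n) :
    ∑ σ : Equiv.Perm (Fin n), (if dd σ = 0 then
      q ^ (2 * pat2_13 σ + pat31_2 σ) * (X ^ des σ * Y ^ (n - 1 - 2 * des σ)) else 0) =
    ∑ u ∈ slotWords n, slotWeight q X Y n u * (if u.count (n + 1) = 0 then 1 else 0) := by
  simp only [← fun σ => slotWeight_wordList (n := n) σ q X Y hn, mul_ite, mul_one, mul_zero]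
  rw [← sum_filter]
  refine sum_bij (fun σ _ => wordList σ) ?_ ?_ ?_ ?_
  · intro σ _
    exact mem_filter.2 ⟨mem_slotWords.2 (isSlotWord_wordList σ hn), count_wordList_succ σ⟩
  · intro σ _ τ _ h
    exact wordList_injective h
  · intro u hu
    rw [mem_filter, mem_slotWords] at hu
    obtain ⟨⟨-, h1, h2, -⟩, h3⟩ := hu
    have hmem : ∀ v ∈ u, v ∈ Icc 1 n := by
      intro v hv
      have := h1 v hv
      have : v ≠ n + 1 := by
        rintro rfl
        exact List.count_eq_zero.1 h3 hv
      rw [mem_Icc]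
      omega
    have hnd : u.Nodup := List.nodup_iff_count_le_one.2 fun v => by
      by_cases hv : v ∈ u
      · have := mem_Icc.1 (hmem v hv)
        rw [h2 v this.1 this.2]
      · rw [List.count_eq_zero.2 hv]
        omega
    have hfin : u.toFinset = Icc 1 n := by
      ext v
      rw [List.mem_toFinset]
      refine ⟨hmem v, fun hv => List.count_pos_iff.1 ?_⟩
      rw [mem_Icc] at hv
      rw [h2 v hv.1 hv.2]
      exact one_pos
    have hlen : u.length = n := by
      rw [← List.toFinset_card_of_nodup hnd, hfin, Nat.card_Icc, Nat.add_sub_cancel]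
    obtain ⟨σ, hσ⟩ := exists_wordList_eq hlen hmem hnd
    exact ⟨σ, mem_univ _, hσ⟩
  · intro σ _
    rfl

theorem sum_DD_eq_sum_perm {R : Type*} [CommSemiring R] (q X Y : R) {n : ℕ} (hn : 1 ≤ n) :
    ∑ k ∈ range ((n - 1) / 2 + 1), (∑ σ ∈ DD n k, q ^ (2 * pat2_13 σ + pat31_2 σ)) *
        X ^ k * Y ^ (n - 1 - 2 * k) =
      ∑ σ : Equiv.Perm (Fin n), (if dd σ = 0 then
        q ^ (2 * pat2_13 σ + pat31_2 σ) * (X ^ des σ * Y ^ (n - 1 - 2 * des σ)) else 0) := by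
  rw [← sum_filter, ← sum_fiberwise_of_maps_to (t := range ((n - 1) / 2 + 1)) (g := des)]
  · refine sum_congr rfl fun k _ => ?_
    rw [sum_mul, sum_mul, filter_filter]
    have : DD n k = ({σ | dd σ = 0 ∧ des σ = k} : Finset (Equiv.Perm (Fin n))) := by
      rw [DD]
      exact filter_congr fun σ _ => and_comm
    rw [this]
    refine sum_congr rfl fun σ hσ => ?_
    rw [(mem_filter.1 hσ).2.2, mul_assoc]
  · intro σ hσ
    have := two_mul_des_le σ hn (mem_filter.1 hσ).2
    rw [mem_range]
    omega

end WordStatistics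

section Comparison

variable {R : Type*} [CommSemiring R]

/-- The product `q · q² ⋯ q^h`. -/
def qPowProd (q : R) : ℕ → R
  | 0 => 1
  | h + 1 => qPowProd q h * q ^ (h + 1)

/-- The `q`-factorial. -/
def qFact (q : R) : ℕ → R
  | 0 => 1
  | h + 1 => qFact q h * brk 1 q (h + 1)

theorem rowStep_colStep_eq (q t : R) {H Z : ℕ → R} (hZ : Z 0 = 0)
    (h : ∀ k, qPowProd q k * H k = qFact q k * Z (k + 1)) (k : ℕ) :
    qPowProd q k * rowStep q t (colStep q H) k =
      qFact q k * slotStep q t (1 + t) Z (k + 1) := by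
  rw [slotStep, brk_sq, Nat.add_sub_cancel]
  cases k with
  | zero =>
    have h0 := h 0
    have h1 := h 1
    simp only [qPowProd, qFact, brk, zero_add, pow_one, pow_zero, one_mul, mul_zero, add_zero,
      mul_one] at h0 h1
    simp only [rowStep, colStep, qPowProd, qFact, brk, zero_add, pow_one, pow_zero, one_mul,
      mul_zero, add_zero, zero_mul, mul_one, h0, h1, hZ, Nat.sub_self]
    ring
  | succ k =>
    have e : qPowProd q (k + 1) * rowStep q t (colStep q H) (k + 1) =
        brk 1 q (k + 2) * brk 1 q (k + 1) * q ^ (k + 1) * (qPowProd q k * H k) +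
        (1 + t) * q ^ (k + 1) * brk 1 q (k + 2) * (qPowProd q (k + 1) * H (k + 1)) +
        t * q ^ (k + 1) * (qPowProd q (k + 2) * H (k + 2)) := by
      simp only [rowStep, colStep, qPowProd, Nat.add_sub_cancel]
      ring
    rw [e, h, h, h]
    simp only [qFact]
    ring

theorem iterate_rowStep_eq (q t : R) (n k : ℕ) :
    qPowProd q k * rowStep q t ((fun G => colStep q (rowStep q t G))^[n]
        fun k => if k = 0 then 1 else 0) k =
      qFact q k * (slotStep q t (1 + t))^[n + 1] (fun k => if k = 0 then 1 else 0) (k + 1) := by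
  induction n generalizing k with
  | zero =>
    cases k with
    | zero => simp [rowStep, slotStep, qPowProd, qFact, brk]
    | succ k => simp [rowStep, slotStep]
  | succ n ih =>
    rw [Function.iterate_succ_apply', Function.iterate_succ_apply' _ (n + 1)]
    refine rowStep_colStep_eq q t ?_ ih k
    rw [Function.iterate_succ_apply']
    simp [slotStep, brk]

theorem iterate_colStep_zero (q t : R) (n : ℕ) :
    (fun G => colStep q (rowStep q t G))^[n + 1] (fun k => if k = 0 then 1 else 0) 0 =
      (slotStep q t (1 + t))^[n + 1] (fun k => if k = 0 then 1 else 0) 1 := by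
  have h := iterate_rowStep_eq q t n 0
  simp only [qPowProd, qFact, one_mul, zero_add] at h
  rw [← h, Function.iterate_succ_apply']
  simp [colStep, brk]

end Comparison

end PermStat

/-- The identity is stated for elements `q`, `t` of an arbitrary commutative semiring, which
includes the case of two indeterminates. -/
theorem theorem1p1 {R : Type*} [CommSemiring R] (q t : R) (n : ℕ) (hn : 1 ≤ n) :
    ∑ σ : Equiv.Perm (Fin n),
        q ^ (PermStat.inv σ - PermStat.exc σ) * t ^ PermStat.exc σ =
      ∑ k ∈ Finset.range ((n - 1) / 2 + 1),
        (∑ σ ∈ PermStat.DD n k, q ^ (2 * PermStat.pat2_13 σ + PermStat.pat31_2 σ)) *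
          t ^ k * (1 + t) ^ (n - 1 - 2 * k) := by
  rw [PermStat.sum_DD_eq_sum_perm q t (1 + t) hn, PermStat.sum_perm_eq_sum_slotWords q t _ hn,
    PermStat.sum_perm_eq_sum_partialWords,
    PermStat.sum_partialWords q t n fun k => if k = 0 then 1 else 0,
    PermStat.sum_slotWords q t (1 + t) n fun k => if k = 0 then 1 else 0]
  obtain ⟨n, rfl⟩ : ∃ m, n = m + 1 := ⟨n - 1, by omega⟩
  exact PermStat.iterate_colStep_zero q t n
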